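/- **Setting.** Let $d_1\ge d_2$ and $r\ge 1$ be integers and let $M_\star\in\mathbb R^{d_1\times d_2}$ have rank $r$ and SVD $M_\star=U_\star\Sigma_\star V_\star^\top$ with $U_\star\in\mathbb R^{d_1\times r}$, $V_\star\in\mathbb R^{d_2\times r}$ having orthonormal columns and $\Sigma_\star$ diagonal with positive diagonal. Let $\sigma_{\max}$ and $\sigma_{\min}$ be the largest and the smallest diagonal entries of $\Sigma_\star$, $\kappa=\sigma_{\max}/\sigma_{\min}$, $X_\star=U_\star\Sigma_\star^{1/2}$, $Y_\star=V_\star\Sigma_\star^{1/2}$, $F_\star=\begin{bmatrix}X_\star\\ Y_\star\end{bmatrix}$. Assume that $M_\star$ is $\mu$-incoherent: every row of $U_\star$ has Euclidean norm at most $\sqrt{\mu r/d_1}$ and every row of $V_\star$ at most $\sqrt{\mu r/d_2}$. Let $0<p\le 1$ and let the random set $\Omega\subseteq[d_1]\times[d_2]$ contain each position independently with probability $p$. For a set $S$ of positions, $\mathcal P_S$ keeps the entries in $S$ and sets the others to $0$. $\|\cdot\|$ is the spectral norm, $\|\cdot\|_F$ the Frobenius norm, $\mathcal O_r$ the group of orthogonal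 $r\times r$ matrices. **Iterates.** A *spectral initialization* from a matrix $A$ is $(U\Sigma^{1/2},V\Sigma^{1/2})$, where $U\Sigma V^\top$ is a truncated rank-$r$ SVD of $A$. *Vanilla gradient descent* (VGD) with step size $s$ starts from the spectral initialization $(X_0,Y_0)$ from $\frac1p\mathcal P_\Omega(M_\star)$ and iterates $$X_{k+1}=X_k-\tfrac sp\mathcal P_\Omega(X_kY_k^\top-M_\star)Y_k,\qquad Y_{k+1}=Y_k-\tfrac sp\mathcal P_\Omega(X_kY_k^\top-M_\star)^\top X_k .$$ For $1\le l\le d_1+d_2$ let $L_l$ be the set of positions in row $l$ if $l\le d_1$, and in column $l-d_1$ if $l>d_1$, and let $\mathcal A_l=\frac1p\mathcal P_{\Omega\setminus L_l}+\mathcal P_{L_l}$. The *leave-one-out sequence* $(X_k^{(l)},Y_k^{(l)})$ starts from the spectral initialization from $\mathcal A_l(M_\star)$ and iterates (superscripts $(l)$ omitted on the right) $$X_{k+1}^{(l)}=X_k-s\,\mathcal A_l(X_kY_k^\top-M_\star)Y_k-\tfrac s2X_k(X_k^\top X_k-Y_k^\top Y_k),$$ $$Y_{k+1}^{(l)}=Y_k-s\,\mathcal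 A_l(X_kY_k^\top-M_\star)^\top X_k-\tfrac s2Y_k(Y_k^\top Y_k-X_k^\top X_k).$$ Put $F_k=\begin{bmatrix}X_k\\ Y_k\end{bmatrix}$, $F_k^{(l)}=\begin{bmatrix}X_k^{(l)}\\ Y_k^{(l)}\end{bmatrix}$, and let $O_k$, $O_k^{(l)}$, $R_k^{(l)}$ be minimizers over $O\in\mathcal O_r$ of $\|F_kO-F_\star\|_F$, $\|F_k^{(l)}O-F_\star\|_F$ and $\|F_kO_k-F_k^{(l)}O\|_F$, respectively. Let $$\mathrm{dist}(F_k,F_\star)=\sqrt{\inf_{Q\in \mathrm{GL}(r)}\left(\|X_kQ-X_\star\|_F^2+\|Y_kQ^{-\top}-Y_\star\|_F^2\right)},$$ and call $Q_k\in\mathrm{GL}(r)$ an optimal alignment matrix if it attains this infimum. **Induction hypothesis at step $k$.** For all $0\le t\le k$: (a) $\|F_tO_t-F_\star\|\le\Big(s\sigma_{\min}+\sqrt{\frac{\mu r\kappa^6\log d_1}{pd_2}}\Big)\sqrt{\sigma_{\max}}$; (b) for all $l$, the $l$-th row of $F_t^{(l)}O_t^{(l)}-F_\star$ has Euclidean norm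 at most $\Big(10^3s\kappa^2\sigma_{\min}+10^2\sqrt{\frac{\mu^2r^2\kappa^{14}\log d_1}{pd_2}}\Big)\sqrt{\frac{\mu r\sigma_{\max}}{d_2}}$; (c) for all $l$, $\|F_tO_t-F_t^{(l)}R_t^{(l)}\|_F\le\Big(\frac{s\sigma_{\min}}{\kappa}+\sqrt{\frac{\mu^2r^2\kappa^{10}\log d_1}{pd_2^2}}\Big)\sqrt{\sigma_{\max}}$; (d) $\mathrm{dist}(F_t,F_\star)\le\big(1-\frac{s\sigma_{\min}}{100}\big)^t\,\mathrm{dist}(F_0,F_\star)$; (e) an optimal alignment matrix $Q_t$ exists with $\|Q_t-O_t\|\le\frac1{400\kappa}$. **Lemma 4.** There are universal constants $C_3,C_4>0$ such that the following holds. In the setting above suppose that $$p\ge\frac{C_3\mu^3r^3\kappa^{16}\max\{d_1,d_2\}\log(\max\{d_1,d_2\})}{\min\{d_1,d_2\}^2}.$$ Then with probability at least $1-(d_1+d_2)^{-11}$ over $\Omega$, for every step size $$0<s\le\frac{\min\{d_1,d_2\}}{C_4\max\{d_1,d_2\}^{3/2}\sqrt{\mu r}\,\kappa^4\sigma_{\max}}$$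 and every $k\ge 0$: if the induction hypothesis holds at step $k$, then $$\|X_k^\top X_k-Y_k^\top Y_k\|_F\le\frac{s\,\sigma_{\min}^2}{100\,\kappa}.$$ -/

import Mathlib

open scoped Matrix MatrixGroups

noncomputable section

/-! Norms of real matrices. -/

open scoped Matrix.Norms.Frobenius in
/-- The Frobenius norm. -/
def frobNorm {m n : Type*} [Fintype m] [Fintype n] (A : Matrix m n ℝ) : ℝ := ‖A‖

open scoped Matrix.Norms.L2Operator in
/-- The spectral norm (operator norm between Euclidean spaces). -/
def opNorm {m n : Type*} [Fintype m] [Fintype n] [DecidableEq n] (A : Matrix m n ℝ) : ℝ := ‖A‖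

/-- The Euclidean norm of the row with index `l`. -/
def rowNorm {m n : Type*} [Fintype n] (A : Matrix m n ℝ) (l : m) : ℝ :=
  Real.sqrt (∑ j, A l j ^ 2)

/-- The largest Euclidean norm of a row. -/
def twoInfNorm {m n : Type*} [Fintype n] (A : Matrix m n ℝ) : ℝ := ⨆ l, rowNorm A l

/-! Singular value decompositions. -/

/-- `A = U diag(σ) Vᵀ` with orthonormal columns of `U` and `V` and
`σ` nonnegative and nonincreasing. -/
structure IsSVD {m n : Type*} [Fintype m] [Fintype n] {k : ℕ} (A : Matrix m n ℝ)
    (U : Matrix m (Fin k) ℝ) (σ : Fin k → ℝ) (V : Matrix n (Fin k) ℝ) : Prop where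
  left_orthonormal : Uᵀ * U = 1
  right_orthonormal : Vᵀ * V = 1
  nonneg : ∀ i, 0 ≤ σ i
  antitone : Antitone σ
  eq : A = U * Matrix.diagonal σ * Vᵀ

/-- The SVD of a matrix of rank `r`: all `r` singular values in it are positive. -/
def IsCompactSVD {m n : Type*} [Fintype m] [Fintype n] {r : ℕ} (A : Matrix m n ℝ)
    (U : Matrix m (Fin r) ℝ) (σ : Fin r → ℝ) (V : Matrix n (Fin r) ℝ) : Prop :=
  IsSVD A U σ V ∧ ∀ i, 0 < σ i

/-- `U diag(σ) Vᵀ` is a truncated rank-`r` SVD of `A`: it consists of the first `r` singular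
triples of an SVD of `A` with all `min d₁ d₂` singular values. -/
def IsTruncatedSVD {d₁ d₂ r : ℕ} (A : Matrix (Fin d₁) (Fin d₂) ℝ)
    (U : Matrix (Fin d₁) (Fin r) ℝ) (σ : Fin r → ℝ) (V : Matrix (Fin d₂) (Fin r) ℝ) : Prop :=
  ∃ (hr : r ≤ min d₁ d₂) (U' : Matrix (Fin d₁) (Fin (min d₁ d₂)) ℝ)
    (σ' : Fin (min d₁ d₂) → ℝ) (V' : Matrix (Fin d₂) (Fin (min d₁ d₂)) ℝ),
    IsSVD A U' σ' V' ∧ U = U'.submatrix id (Fin.castLE hr) ∧ σ = σ' ∘ Fin.castLE hr ∧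
      V = V'.submatrix id (Fin.castLE hr)

/-- `U diag(σ)^{1/2}`. -/
def halfFactor {m : Type*} {r : ℕ} (U : Matrix m (Fin r) ℝ) (σ : Fin r → ℝ) :
    Matrix m (Fin r) ℝ := U * Matrix.diagonal fun i => Real.sqrt (σ i)

/-- `(X₀, Y₀)` is the spectral initialization obtained from `A`. -/
def IsSpectralInit {d₁ d₂ r : ℕ} (A : Matrix (Fin d₁) (Fin d₂) ℝ)
    (X₀ : Matrix (Fin d₁) (Fin r) ℝ) (Y₀ : Matrix (Fin d₂) (Fin r) ℝ) : Prop :=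
  ∃ U σ V, IsTruncatedSVD A U σ V ∧ X₀ = halfFactor U σ ∧ Y₀ = halfFactor V σ

/-- The largest of the singular values in a compact SVD. -/
def sigmaMax {r : ℕ} (σ : Fin r → ℝ) : ℝ := ⨆ i, σ i

/-- The smallest of the (nonzero) singular values in a compact SVD. -/
def sigmaMin {r : ℕ} (σ : Fin r → ℝ) : ℝ := ⨅ i, σ i

/-- The condition number. -/
def condNumber {r : ℕ} (σ : Fin r → ℝ) : ℝ := sigmaMax σ / sigmaMin σ

/-- `μ`-incoherence in terms of the singular vectors. -/
def IsIncoherent {d₁ d₂ r : ℕ} (μ : ℝ) (U : Matrix (Fin d₁) (Fin r) ℝ)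
    (V : Matrix (Fin d₂) (Fin r) ℝ) : Prop :=
  twoInfNorm U ≤ Real.sqrt (μ * r / d₁) ∧ twoInfNorm V ≤ Real.sqrt (μ * r / d₂)

/-! Sampling and gradient descent. -/

open Classical in
/-- The projection that keeps the entries with positions in `S` and sets the others to zero. -/
def proj {m n : Type*} (S : Set (m × n)) (A : Matrix m n ℝ) : Matrix m n ℝ :=
  Matrix.of fun i j => if (i, j) ∈ S then A i j else 0

/-- Vanilla gradient descent for the matrix completion objective
`‖proj Ω (X Yᵀ - M)‖² / (2 p)` (Frobenius norm) with step size `s` and spectral initialization. -/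
structure IsVanillaGD {d₁ d₂ r : ℕ} (M : Matrix (Fin d₁) (Fin d₂) ℝ) (p s : ℝ)
    (Ω : Set (Fin d₁ × Fin d₂)) (X : ℕ → Matrix (Fin d₁) (Fin r) ℝ)
    (Y : ℕ → Matrix (Fin d₂) (Fin r) ℝ) : Prop where
  init : IsSpectralInit (p⁻¹ • proj Ω M) (X 0) (Y 0)
  stepX : ∀ k, X (k + 1) = X k - (s / p) • (proj Ω (X k * (Y k)ᵀ - M) * Y k)
  stepY : ∀ k, Y (k + 1) = Y k - (s / p) • ((proj Ω (X k * (Y k)ᵀ - M))ᵀ * X k)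

/-- The positions in the row (`Sum.inl`) or in the column (`Sum.inr`) that is left out. -/
def line {m n : Type*} : m ⊕ n → Set (m × n)
  | Sum.inl i => {q | q.1 = i}
  | Sum.inr j => {q | q.2 = j}

/-- The leave-one-out sampling operator: `p⁻¹` times the projection onto the samples outside of
the row or column `l`, plus the projection onto the whole row or column `l`. -/
def looOp {m n : Type*} (p : ℝ) (Ω : Set (m × n)) (l : m ⊕ n) (A : Matrix m n ℝ) :
    Matrix m n ℝ :=
  p⁻¹ • proj (Ω \ line l) A + proj (line l) A

/-- The leave-one-out sequence for the row or column `l`: gradient descent with spectral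
initialization for the leave-one-out problem with the balancing term
`‖Xᵀ X - Yᵀ Y‖² / 8` (Frobenius norm). -/
structure IsLeaveOneOutGD {d₁ d₂ r : ℕ} (M : Matrix (Fin d₁) (Fin d₂) ℝ) (p s : ℝ)
    (Ω : Set (Fin d₁ × Fin d₂)) (l : Fin d₁ ⊕ Fin d₂) (X : ℕ → Matrix (Fin d₁) (Fin r) ℝ)
    (Y : ℕ → Matrix (Fin d₂) (Fin r) ℝ) : Prop where
  init : IsSpectralInit (looOp p Ω l M) (X 0) (Y 0)
  stepX : ∀ k, X (k + 1) = X k - s • (looOp p Ω l (X k * (Y k)ᵀ - M) * Y k)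
    - (s / 2) • (X k * ((X k)ᵀ * X k - (Y k)ᵀ * Y k))
  stepY : ∀ k, Y (k + 1) = Y k - s • ((looOp p Ω l (X k * (Y k)ᵀ - M))ᵀ * X k)
    - (s / 2) • (Y k * ((Y k)ᵀ * Y k - (X k)ᵀ * X k))

/-! Alignment. -/

/-- `O` is an orthogonal matrix that minimizes `‖A O - B‖` (Frobenius norm) among all of them. -/
def IsBestRotation {m : Type*} [Fintype m] {r : ℕ} (A B : Matrix m (Fin r) ℝ)
    (O : Matrix (Fin r) (Fin r) ℝ) : Prop :=
  O ∈ Matrix.orthogonalGroup (Fin r) ℝ ∧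
    ∀ O' ∈ Matrix.orthogonalGroup (Fin r) ℝ, frobNorm (A * O - B) ≤ frobNorm (A * O' - B)

/-- The squared alignment error `‖X Q - X⋆‖² + ‖Y Q⁻ᵀ - Y⋆‖²` (Frobenius norms). -/
def alignError {m n : Type*} [Fintype m] [Fintype n] {r : ℕ} (X Xs : Matrix m (Fin r) ℝ)
    (Y Ys : Matrix n (Fin r) ℝ) (Q : GL (Fin r) ℝ) : ℝ :=
  frobNorm (X * (Q : Matrix (Fin r) (Fin r) ℝ) - Xs) ^ 2
    + frobNorm (Y * ((Q⁻¹ : GL (Fin r) ℝ) : Matrix (Fin r) (Fin r) ℝ)ᵀ - Ys) ^ 2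

/-- The distance up to an invertible alignment. -/
def alignDist {m n : Type*} [Fintype m] [Fintype n] {r : ℕ} (X Xs : Matrix m (Fin r) ℝ)
    (Y Ys : Matrix n (Fin r) ℝ) : ℝ :=
  Real.sqrt (⨅ Q : GL (Fin r) ℝ, alignError X Xs Y Ys Q)

/-- `Q` is an optimal alignment matrix: it attains the infimum in `alignDist`. -/
def IsOptimalAlignment {m n : Type*} [Fintype m] [Fintype n] {r : ℕ} (X Xs : Matrix m (Fin r) ℝ)
    (Y Ys : Matrix n (Fin r) ℝ) (Q : GL (Fin r) ℝ) : Prop :=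
  ∀ Q' : GL (Fin r) ℝ, alignError X Xs Y Ys Q ≤ alignError X Xs Y Ys Q'

/-! The induction hypothesis and the parameter conditions. -/

/-- The induction hypothesis at step `t`. The rows of `F = [X; Y]` are indexed by
`Fin d₁ ⊕ Fin d₂`; `XL l`, `YL l` are the leave-one-out sequences and `Xs`, `Ys` the factors of the
target, whose positive singular values are `σ`. -/
def InductionHypothesisAt {d₁ d₂ r : ℕ} (μ p s : ℝ) (σ : Fin r → ℝ)
    (Xs : Matrix (Fin d₁) (Fin r) ℝ) (Ys : Matrix (Fin d₂) (Fin r) ℝ)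
    (X : ℕ → Matrix (Fin d₁) (Fin r) ℝ) (Y : ℕ → Matrix (Fin d₂) (Fin r) ℝ)
    (XL : Fin d₁ ⊕ Fin d₂ → ℕ → Matrix (Fin d₁) (Fin r) ℝ)
    (YL : Fin d₁ ⊕ Fin d₂ → ℕ → Matrix (Fin d₂) (Fin r) ℝ) (t : ℕ) : Prop :=
  let κ := condNumber σ
  let Fs := Matrix.fromRows Xs Ys
  let F := Matrix.fromRows (X t) (Y t)
  let FL := fun l => Matrix.fromRows (XL l t) (YL l t)
  ∃ O : Matrix (Fin r) (Fin r) ℝ, IsBestRotation F Fs O ∧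
    opNorm (F * O - Fs) ≤
      (s * sigmaMin σ + Real.sqrt (μ * r * κ ^ 6 * Real.log d₁ / (p * d₂)))
        * Real.sqrt (sigmaMax σ) ∧
    (∀ l, ∃ OL : Matrix (Fin r) (Fin r) ℝ, IsBestRotation (FL l) Fs OL ∧
      rowNorm (FL l * OL - Fs) l ≤
        (10 ^ 3 * s * κ ^ 2 * sigmaMin σ
          + 10 ^ 2 * Real.sqrt (μ ^ 2 * r ^ 2 * κ ^ 14 * Real.log d₁ / (p * d₂)))
          * Real.sqrt (μ * r * sigmaMax σ / d₂)) ∧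
    (∀ l, ∃ R : Matrix (Fin r) (Fin r) ℝ, IsBestRotation (FL l) (F * O) R ∧
      frobNorm (F * O - FL l * R) ≤
        (s * sigmaMin σ / κ
          + Real.sqrt (μ ^ 2 * r ^ 2 * κ ^ 10 * Real.log d₁ / (p * (d₂ : ℝ) ^ 2)))
          * Real.sqrt (sigmaMax σ)) ∧
    alignDist (X t) Xs (Y t) Ys ≤
      (1 - s * sigmaMin σ / 100) ^ t * alignDist (X 0) Xs (Y 0) Ys ∧
    ∃ Q : GL (Fin r) ℝ, IsOptimalAlignment (X t) Xs (Y t) Ys Q ∧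
      opNorm ((Q : Matrix (Fin r) (Fin r) ℝ) - O) ≤ 1 / (400 * κ)

/-- The lower bound on the sampling rate. -/
def SamplingRateCondition (C₃ : ℝ) (d₁ d₂ r : ℕ) (μ κ p : ℝ) : Prop :=
  C₃ * μ ^ 3 * r ^ 3 * κ ^ 16 * max (d₁ : ℝ) d₂ * Real.log (max (d₁ : ℝ) d₂)
    / min (d₁ : ℝ) d₂ ^ 2 ≤ p

/-- The range of admissible step sizes. -/
def StepSizeCondition (C₄ : ℝ) (d₁ d₂ r : ℕ) (μ κ σmax s : ℝ) : Prop :=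
  0 < s ∧
    s ≤ min (d₁ : ℝ) d₂
      / (C₄ * max (d₁ : ℝ) d₂ ^ (3 / 2 : ℝ) * Real.sqrt (μ * r) * κ ^ 4 * σmax)

end

/-! The first-order terms cancel in the change of `Xᵀ X - Yᵀ Y` along a gradient step, so the
imbalance grows by at most `s²` times the squared gradient norm `g`
(`frobNorm_balance_gradient_step_le`). The same step lowers the squared residual on `Ω` by at least
`s p g` (`objective_gradient_step_le`). Hence `p · imbalance + s · objective` never increases
(`IsVanillaGD.balance_add_objective_le`). Spectral initialization is exactly balanced, so the
imbalance at every step is at most `s / p` times the initial objective, uniformly in `k`.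

What remains is to bound the initial objective by `p σ_min² / (100 κ)` and to check the smoothness
conditions of the descent step. Hypotheses (b) and (c) bound the rows of the iterates
(`rowNorm_iterate_le`), and (a) bounds the alignment error; together they make the objective small
(`objective_iterate_le`). Randomness enters only through the number of samples per row and column,
controlled by a Chernoff bound; on that event everything is deterministic, hence valid for all `s`
and `k` at once. -/

/-! ### Concentration of row and column degrees. -/

open MeasureTheory ProbabilityTheory in
/-- The exponential moment of the number of points of `T` in a binomial random set. -/
theorem integral_exp_sum_indicator_setBernoulli {ι : Type*} [Fintype ι] (p : unitInterval)
    (T : Finset ι) :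
    ∫ Ω, Real.exp (∑ i ∈ T, Set.indicator Ω (1 : ι → ℝ) i) ∂(setBernoulli (Set.univ : Set ι) p)
      = (1 + p * (Real.exp 1 - 1)) ^ T.card := by
  classical
  have h1 : ∀ Ω : Set ι, Real.exp (∑ i ∈ T, Set.indicator Ω (1 : ι → ℝ) i)
      = ∏ i, (if i ∈ T ∧ i ∈ Ω then Real.exp 1 else 1) := by
    intro Ω
    rw [Real.exp_sum, ← Finset.prod_filter_mul_prod_filter_not Finset.univ (· ∈ T)]
    rw [Finset.prod_eq_one (s := Finset.univ.filter (¬ · ∈ T)), mul_one]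
    · simp only [Finset.filter_mem_eq_inter, Finset.univ_inter]
      refine Finset.prod_congr rfl fun i hi => ?_
      by_cases h : i ∈ Ω <;> simp [h, hi]
    · intro i hi
      simp at hi
      simp [hi]
  simp_rw [h1]
  -- The random set is the image of a family of independent propositions, so the expectation of the
  -- product factorizes.
  rw [setBernoulli_eq_map, integral_map (by fun_prop) (by
    exact (Measurable.of_discrete).aestronglyMeasurable), Measure.infinitePi_eq_pi]
  have h2 := integral_fintype_prod_eq_prod (𝕜 := ℝ) (ι := ι) (E := fun _ => Prop)
    (fun i (q : Prop) => if i ∈ T ∧ q then Real.exp 1 else 1)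
    (μ := fun i => unitInterval.toNNReal p • Measure.dirac (i ∈ (Set.univ : Set ι))
      + unitInterval.toNNReal (unitInterval.symm p) • Measure.dirac False)
  refine Eq.trans ?_ (h2.trans ?_)
  · rfl
  · have h3 : ∀ i, ∫ q : Prop, (if i ∈ T ∧ q then Real.exp 1 else 1)
        ∂(unitInterval.toNNReal p • Measure.dirac (i ∈ (Set.univ : Set ι))
      + unitInterval.toNNReal (unitInterval.symm p) • Measure.dirac False)
        = if i ∈ T then 1 + p * (Real.exp 1 - 1) else 1 := by
      intro i
      rw [integral_add_measure (Integrable.of_finite) (Integrable.of_finite),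
        integral_smul_nnreal_measure, integral_smul_nnreal_measure, integral_dirac, integral_dirac]
      by_cases h : i ∈ T
      · simp [h, NNReal.smul_def]; ring
      · simp [h, NNReal.smul_def]
    simp_rw [h3]
    simp

open MeasureTheory ProbabilityTheory in
/-- A Chernoff bound for the number of points of `T` in a binomial random set. -/
theorem setBernoulli_real_four_mul_lt {ι : Type*} [Fintype ι] (p : unitInterval)
    (T : Finset ι) :
    (setBernoulli (Set.univ : Set ι) p).real
      {Ω | 4 * p * (T.card : ℝ) < ∑ i ∈ T, Set.indicator Ω (1 : ι → ℝ) i}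
      ≤ Real.exp (-(2 * p * (T.card : ℝ))) := by
  have hp : 0 ≤ (p : ℝ) := p.2.1
  have h := mul_meas_ge_le_integral_of_nonneg (μ := setBernoulli (Set.univ : Set ι) p)
    (f := fun Ω => Real.exp (∑ i ∈ T, Set.indicator Ω (1 : ι → ℝ) i))
    (Filter.Eventually.of_forall fun _ => (Real.exp_pos _).le) Integrable.of_finite
    (Real.exp (4 * p * (T.card : ℝ)))
  rw [integral_exp_sum_indicator_setBernoulli] at h
  -- Since `e < 3`, each factor is at most `1 + 2p ≤ exp (2p)`; Markov's inequality at level `exp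
  -- (4p|T|)` then leaves `exp (-2p|T|)`.
  have h2 : (1 + (p : ℝ) * (Real.exp 1 - 1)) ^ T.card ≤ Real.exp (2 * p * T.card) := by
    have h3 : 1 + (p : ℝ) * (Real.exp 1 - 1) ≤ Real.exp (2 * p) := by
      have := Real.add_one_le_exp (2 * (p : ℝ))
      have := Real.exp_one_lt_d9
      nlinarith
    have h4 : 0 ≤ 1 + (p : ℝ) * (Real.exp 1 - 1) := by
      have := Real.add_one_le_exp (1 : ℝ)
      nlinarith
    calc _ ≤ Real.exp (2 * p) ^ T.card := pow_le_pow_left₀ h4 h3 _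
      _ = _ := by rw [← Real.exp_nat_mul]; ring_nf
  have h5 : (setBernoulli (Set.univ : Set ι) p).real
      {Ω | 4 * p * (T.card : ℝ) < ∑ i ∈ T, Set.indicator Ω (1 : ι → ℝ) i}
      ≤ (setBernoulli (Set.univ : Set ι) p).real {Ω | Real.exp (4 * p * (T.card : ℝ)) ≤
        Real.exp (∑ i ∈ T, Set.indicator Ω (1 : ι → ℝ) i)} :=
    measureReal_mono fun Ω (hΩ : _ < _) => Real.exp_le_exp.2 hΩ.le
  have h6 : Real.exp (-(2 * p * (T.card : ℝ)))
      = Real.exp (2 * p * T.card) / Real.exp (4 * p * (T.card : ℝ)) := by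
    rw [← Real.exp_sub]; ring_nf
  rw [h6, le_div_iff₀ (Real.exp_pos _)]
  nlinarith [Real.exp_pos (4 * p * (T.card : ℝ))]

/-- Every row and every column contains at most four times the expected number of points. -/
def HasBoundedDegrees {d₁ d₂ : ℕ} (p : ℝ) (Ω : Set (Fin d₁ × Fin d₂)) : Prop :=
  (∀ i, ∑ j, Set.indicator Ω (1 : Fin d₁ × Fin d₂ → ℝ) (i, j) ≤ 4 * p * d₂) ∧
    ∀ j, ∑ i, Set.indicator Ω (1 : Fin d₁ × Fin d₂ → ℝ) (i, j) ≤ 4 * p * d₁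

open MeasureTheory ProbabilityTheory in
theorem setBernoulli_real_hasBoundedDegrees {d₁ d₂ : ℕ} (p : unitInterval) :
    1 - (d₁ * Real.exp (-(2 * p * d₂)) + d₂ * Real.exp (-(2 * p * d₁))) ≤
      (setBernoulli (Set.univ : Set (Fin d₁ × Fin d₂)) p).real
        {Ω | HasBoundedDegrees (p : ℝ) Ω} := by
  set P := setBernoulli (Set.univ : Set (Fin d₁ × Fin d₂)) p
  have hc : P.real {Ω | HasBoundedDegrees (p : ℝ) Ω}ᶜ = 1 - P.real {Ω | HasBoundedDegrees (p : ℝ) Ω} :=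
    probReal_compl_eq_one_sub (Set.Finite.measurableSet (Set.toFinite _))
  have hr : ∀ i : Fin d₁, P.real
      {Ω | 4 * p * (d₂ : ℝ) < ∑ j, Set.indicator Ω (1 : Fin d₁ × Fin d₂ → ℝ) (i, j)}
      ≤ Real.exp (-(2 * p * d₂)) := fun i => by
    have h := setBernoulli_real_four_mul_lt p
      (Finset.univ.map ⟨fun j : Fin d₂ => (i, j), fun a b h => (Prod.ext_iff.1 h).2⟩)
    simp only [Finset.card_map, Finset.sum_map, Finset.card_univ, Fintype.card_fin] at h
    exact h
  have hcol : ∀ j : Fin d₂, P.real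
      {Ω | 4 * p * (d₁ : ℝ) < ∑ i, Set.indicator Ω (1 : Fin d₁ × Fin d₂ → ℝ) (i, j)}
      ≤ Real.exp (-(2 * p * d₁)) := fun j => by
    have h := setBernoulli_real_four_mul_lt p
      (Finset.univ.map ⟨fun i : Fin d₁ => (i, j), fun a b h => (Prod.ext_iff.1 h).1⟩)
    simp only [Finset.card_map, Finset.sum_map, Finset.card_univ, Fintype.card_fin] at h
    exact h
  have hsub : {Ω | HasBoundedDegrees (p : ℝ) Ω}ᶜ ⊆
      (⋃ i : Fin d₁, {Ω | 4 * p * (d₂ : ℝ) < ∑ j, Set.indicator Ω (1 : Fin d₁ × Fin d₂ → ℝ) (i, j)}) ∪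
      ⋃ j : Fin d₂, {Ω | 4 * p * (d₁ : ℝ) < ∑ i, Set.indicator Ω (1 : Fin d₁ × Fin d₂ → ℝ) (i, j)} := by
    intro Ω hΩ
    by_contra h
    simp only [Set.mem_union, Set.mem_iUnion, Set.mem_ofPred_eq, not_or, not_exists, not_lt] at h
    exact hΩ h
  have h1 := (measureReal_mono (μ := P) hsub).trans (measureReal_union_le _ _)
  have h2 := (measureReal_iUnion_fintype_le (μ := P)
    fun i : Fin d₁ => {Ω | 4 * p * (d₂ : ℝ) < ∑ j, Set.indicator Ω (1 : Fin d₁ × Fin d₂ → ℝ) (i, j)}).trans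
    (Finset.sum_le_sum fun i _ => hr i)
  have h3 := (measureReal_iUnion_fintype_le (μ := P)
    fun j : Fin d₂ => {Ω | 4 * p * (d₁ : ℝ) < ∑ i, Set.indicator Ω (1 : Fin d₁ × Fin d₂ → ℝ) (i, j)}).trans
    (Finset.sum_le_sum fun i _ => hcol i)
  simp only [Finset.sum_const, Finset.card_univ, Fintype.card_fin, nsmul_eq_mul] at h2 h3
  linarith

/-! ### Frobenius norm and inner product. -/

section FrobeniusNorm

variable {m n l : Type*} [Fintype m] [Fintype n] [Fintype l]

theorem frobNorm_nonneg (A : Matrix m n ℝ) : 0 ≤ frobNorm A := by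
  open scoped Matrix.Norms.Frobenius in exact norm_nonneg A

theorem frobNorm_sq (A : Matrix m n ℝ) : frobNorm A ^ 2 = ∑ i, ∑ j, A i j ^ 2 := by
  have h : (0 : ℝ) ≤ ∑ i, ∑ j, A i j ^ 2 :=
    Finset.sum_nonneg fun i _ => Finset.sum_nonneg fun j _ => sq_nonneg _
  rw [frobNorm, Matrix.frobenius_norm_def, ← Real.sqrt_eq_rpow]
  simpa using Real.sq_sqrt h

theorem frobNorm_add_le (A B : Matrix m n ℝ) : frobNorm (A + B) ≤ frobNorm A + frobNorm B := by
  open scoped Matrix.Norms.Frobenius in exact norm_add_le A B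

theorem frobNorm_sub_le (A B : Matrix m n ℝ) : frobNorm (A - B) ≤ frobNorm A + frobNorm B := by
  open scoped Matrix.Norms.Frobenius in exact norm_sub_le A B

theorem frobNorm_smul (c : ℝ) (A : Matrix m n ℝ) : frobNorm (c • A) = |c| * frobNorm A := by
  open scoped Matrix.Norms.Frobenius in exact norm_smul c A

theorem frobNorm_zero : frobNorm (0 : Matrix m n ℝ) = 0 := by
  open scoped Matrix.Norms.Frobenius in exact norm_zero

theorem frobNorm_mul_le (A : Matrix m n ℝ) (B : Matrix n l ℝ) :
    frobNorm (A * B) ≤ frobNorm A * frobNorm B :=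
  Matrix.frobenius_norm_mul A B

theorem frobNorm_transpose (A : Matrix m n ℝ) : frobNorm Aᵀ = frobNorm A :=
  Matrix.frobenius_norm_transpose A

theorem frobNorm_add_sq_le (A B : Matrix m n ℝ) :
    frobNorm (A + B) ^ 2 ≤ 2 * (frobNorm A ^ 2 + frobNorm B ^ 2) := by
  have h := frobNorm_add_le A B
  have h0 := frobNorm_nonneg (A + B)
  nlinarith [sq_nonneg (frobNorm A - frobNorm B)]

theorem frobNorm_fromRows_sq (A : Matrix m l ℝ) (B : Matrix n l ℝ) :
    frobNorm (Matrix.fromRows A B) ^ 2 = frobNorm A ^ 2 + frobNorm B ^ 2 := by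
  simp [frobNorm_sq]

/-- Each of the `r` columns is the image of a unit vector. -/
theorem frobNorm_sq_le_card_mul_opNorm_sq {r : ℕ} (A : Matrix m (Fin r) ℝ) :
    frobNorm A ^ 2 ≤ r * opNorm A ^ 2 := by
  rw [frobNorm_sq, Finset.sum_comm]
  have h : ∀ j, ∑ i, A i j ^ 2 ≤ opNorm A ^ 2 := by
    intro j
    have h1 := Matrix.l2_opNorm_mulVec A (EuclideanSpace.single j (1 : ℝ))
    rw [PiLp.norm_single, norm_one, mul_one] at h1
    have h2 := pow_le_pow_left₀ (norm_nonneg _) h1 2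
    rw [EuclideanSpace.norm_sq_eq] at h2
    simpa [opNorm] using h2
  calc _ ≤ ∑ _j : Fin r, opNorm A ^ 2 := Finset.sum_le_sum fun j _ => h j
    _ = _ := by simp

/-- The Frobenius inner product. -/
def frobInner (A B : Matrix m n ℝ) : ℝ := ∑ i, ∑ j, A i j * B i j

theorem frobInner_eq_trace (A B : Matrix m n ℝ) : frobInner A B = (Aᵀ * B).trace := by
  simp [frobInner, Matrix.trace, Matrix.mul_apply]
  exact Finset.sum_comm

theorem frobInner_self (A : Matrix m n ℝ) : frobInner A A = frobNorm A ^ 2 := by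
  rw [frobNorm_sq]
  simp only [frobInner, sq]

theorem frobInner_add_right (A B C : Matrix m n ℝ) :
    frobInner A (B + C) = frobInner A B + frobInner A C := by
  simp [frobInner, mul_add, Finset.sum_add_distrib]

theorem frobInner_smul_right (c : ℝ) (A B : Matrix m n ℝ) :
    frobInner A (c • B) = c * frobInner A B := by
  simp [frobInner, Finset.mul_sum, mul_left_comm]

theorem frobInner_smul_left (c : ℝ) (A B : Matrix m n ℝ) :
    frobInner (c • A) B = c * frobInner A B := by
  simp [frobInner, Finset.mul_sum, mul_assoc]

theorem frobInner_le (A B : Matrix m n ℝ) : frobInner A B ≤ frobNorm A * frobNorm B := by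
  have h := Finset.sum_mul_sq_le_sq_mul_sq Finset.univ (fun q : m × n => A q.1 q.2)
    (fun q => B q.1 q.2)
  simp only [Fintype.sum_prod_type] at h
  rw [← frobNorm_sq, ← frobNorm_sq, ← mul_pow] at h
  exact le_of_sq_le_sq h (mul_nonneg (frobNorm_nonneg A) (frobNorm_nonneg B))

theorem frobNorm_sub_smul_sq (c : ℝ) (A B : Matrix m n ℝ) :
    frobNorm (A - c • B) ^ 2
      = frobNorm A ^ 2 - 2 * c * frobInner A B + c ^ 2 * frobNorm B ^ 2 := by
  simp only [frobNorm_sq, frobInner, Finset.mul_sum, ← Finset.sum_add_distrib,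
    ← Finset.sum_sub_distrib]
  refine Finset.sum_congr rfl fun i _ => Finset.sum_congr rfl fun j _ => ?_
  simp only [Matrix.sub_apply, Matrix.smul_apply, smul_eq_mul]
  ring

theorem frobInner_mul_transpose_left (D : Matrix m n ℝ) (W : Matrix m l ℝ) (Y : Matrix n l ℝ) :
    frobInner D (W * Yᵀ) = frobInner (D * Y) W := by
  rw [frobInner_eq_trace, frobInner_eq_trace, Matrix.transpose_mul, ← Matrix.mul_assoc,
    Matrix.trace_mul_comm, ← Matrix.mul_assoc]

theorem frobInner_mul_transpose_right (D : Matrix m n ℝ) (X : Matrix m l ℝ) (V : Matrix n l ℝ) :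
    frobInner D (X * Vᵀ) = frobInner (Dᵀ * X) V := by
  rw [frobInner_eq_trace, ← Matrix.mul_assoc, frobInner_eq_trace, ← Matrix.trace_transpose]
  simp only [Matrix.transpose_mul, Matrix.transpose_transpose]
  rw [Matrix.trace_mul_comm]

end FrobeniusNorm

/-! ### Sampled low-rank products. -/

section Sampling

variable {m n l : Type*} [Fintype m] [Fintype n] [Fintype l]

theorem proj_sub {m n : Type*} (S : Set (m × n)) (A B : Matrix m n ℝ) : proj S (A - B) = proj S A - proj S B := by
  ext i j
  by_cases h : (i, j) ∈ S <;> simp [proj, h]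

theorem proj_add {m n : Type*} (S : Set (m × n)) (A B : Matrix m n ℝ) : proj S (A + B) = proj S A + proj S B := by
  ext i j
  by_cases h : (i, j) ∈ S <;> simp [proj, h]

theorem proj_smul {m n : Type*} (S : Set (m × n)) (c : ℝ) (A : Matrix m n ℝ) : proj S (c • A) = c • proj S A := by
  ext i j
  by_cases h : (i, j) ∈ S <;> simp [proj, h]

theorem frobInner_proj_proj (S : Set (m × n)) (A B : Matrix m n ℝ) :
    frobInner (proj S A) (proj S B) = frobInner (proj S A) B := by
  refine Finset.sum_congr rfl fun i _ => Finset.sum_congr rfl fun j _ => ?_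
  by_cases h : (i, j) ∈ S <;> simp [proj, h]

theorem proj_apply_sq {m n : Type*} (S : Set (m × n)) (A : Matrix m n ℝ) (i : m) (j : n) :
    proj S A i j ^ 2 = S.indicator (1 : m × n → ℝ) (i, j) * A i j ^ 2 := by
  by_cases h : (i, j) ∈ S <;> simp [proj, h]

theorem indicator_one_nonneg {ι : Type*} (S : Set ι) (q : ι) :
    0 ≤ S.indicator (1 : ι → ℝ) q :=
  Set.indicator_nonneg (fun _ _ => zero_le_one) q

theorem mul_transpose_apply_sq_le {m n l : Type*} [Fintype l] (A : Matrix m l ℝ) (B : Matrix n l ℝ) (i : m) (j : n) :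
    (A * Bᵀ) i j ^ 2 ≤ (∑ k, A i k ^ 2) * ∑ k, B j k ^ 2 := by
  simpa [Matrix.mul_apply] using Finset.sum_mul_sq_le_sq_mul_sq Finset.univ (A i) (B j)

/-- By Cauchy–Schwarz an entry in row `i` has square at most `β` times the squared norm of row `i`
of `A`, and `S` keeps at most `K` such entries. Degree bounds thus suffice, without concentration of
the sampling operator. -/
theorem frobNorm_proj_mul_transpose_sq_le_left {S : Set (m × n)} {K β : ℝ} (A : Matrix m l ℝ)
    {B : Matrix n l ℝ} (hS : ∀ i, ∑ j, S.indicator (1 : m × n → ℝ) (i, j) ≤ K) (hβ : 0 ≤ β)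
    (hB : ∀ j, ∑ k, B j k ^ 2 ≤ β) :
    frobNorm (proj S (A * Bᵀ)) ^ 2 ≤ K * β * frobNorm A ^ 2 := by
  rw [frobNorm_sq, frobNorm_sq, Finset.mul_sum]
  refine Finset.sum_le_sum fun i _ => ?_
  have hA : 0 ≤ ∑ k, A i k ^ 2 := Finset.sum_nonneg fun k _ => sq_nonneg _
  calc ∑ j, proj S (A * Bᵀ) i j ^ 2
      ≤ ∑ j, S.indicator (1 : m × n → ℝ) (i, j) * (β * ∑ k, A i k ^ 2) := by
        refine Finset.sum_le_sum fun j _ => ?_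
        rw [proj_apply_sq]
        refine mul_le_mul_of_nonneg_left ?_ (indicator_one_nonneg S _)
        refine (mul_transpose_apply_sq_le A B i j).trans ?_
        rw [mul_comm]
        exact mul_le_mul_of_nonneg_right (hB j) hA
    _ ≤ K * (β * ∑ k, A i k ^ 2) := by
        rw [← Finset.sum_mul]
        exact mul_le_mul_of_nonneg_right (hS i) (mul_nonneg hβ hA)
    _ = _ := by ring

theorem frobNorm_proj_mul_transpose_sq_le_right {S : Set (m × n)} {K β : ℝ} {A : Matrix m l ℝ}
    (B : Matrix n l ℝ) (hS : ∀ j, ∑ i, S.indicator (1 : m × n → ℝ) (i, j) ≤ K) (hβ : 0 ≤ β)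
    (hA : ∀ i, ∑ k, A i k ^ 2 ≤ β) :
    frobNorm (proj S (A * Bᵀ)) ^ 2 ≤ K * β * frobNorm B ^ 2 := by
  rw [frobNorm_sq, frobNorm_sq, Finset.mul_sum, Finset.sum_comm]
  refine Finset.sum_le_sum fun j _ => ?_
  have hB : 0 ≤ ∑ k, B j k ^ 2 := Finset.sum_nonneg fun k _ => sq_nonneg _
  calc ∑ i, proj S (A * Bᵀ) i j ^ 2
      ≤ ∑ i, S.indicator (1 : m × n → ℝ) (i, j) * (β * ∑ k, B j k ^ 2) := by
        refine Finset.sum_le_sum fun i _ => ?_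
        rw [proj_apply_sq]
        refine mul_le_mul_of_nonneg_left ?_ (indicator_one_nonneg S _)
        exact (mul_transpose_apply_sq_le A B i j).trans (mul_le_mul_of_nonneg_right (hA i) hB)
    _ ≤ K * (β * ∑ k, B j k ^ 2) := by
        rw [← Finset.sum_mul]
        exact mul_le_mul_of_nonneg_right (hS j) (mul_nonneg hβ hB)
    _ = _ := by ring

end Sampling

/-! ### Balance and descent along gradient steps. -/

section GradientDescent

/-- Along a simultaneous gradient step, `Xᵀ X - Yᵀ Y` changes only to second order. -/
theorem balance_gradient_step {m n l : Type*} [Fintype m] [Fintype n] [Fintype l]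
    (D : Matrix m n ℝ) (X : Matrix m l ℝ) (Y : Matrix n l ℝ) (s : ℝ) :
    (X - s • (D * Y))ᵀ * (X - s • (D * Y)) - (Y - s • (Dᵀ * X))ᵀ * (Y - s • (Dᵀ * X))
      = Xᵀ * X - Yᵀ * Y + s ^ 2 • ((D * Y)ᵀ * (D * Y) - (Dᵀ * X)ᵀ * (Dᵀ * X)) := by
  -- These two identities make the terms linear in `s` coincide in both Gram matrices.
  have h1 : (D * Y)ᵀ * X = Yᵀ * (Dᵀ * X) := by rw [Matrix.transpose_mul, Matrix.mul_assoc]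
  have h2 : Xᵀ * (D * Y) = (Dᵀ * X)ᵀ * Y := by
    rw [Matrix.transpose_mul, Matrix.transpose_transpose, Matrix.mul_assoc]
  simp only [Matrix.transpose_sub, Matrix.transpose_smul, Matrix.sub_mul, Matrix.mul_sub,
    Matrix.smul_mul, Matrix.mul_smul, smul_smul, h1, h2, smul_sub, sq]
  abel

theorem frobNorm_balance_gradient_step_le {m n l : Type*} [Fintype m] [Fintype n] [Fintype l]
    (D : Matrix m n ℝ) (X : Matrix m l ℝ) (Y : Matrix n l ℝ) (s : ℝ) :
    frobNorm ((X - s • (D * Y))ᵀ * (X - s • (D * Y)) - (Y - s • (Dᵀ * X))ᵀ * (Y - s • (Dᵀ * X)))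
      ≤ frobNorm (Xᵀ * X - Yᵀ * Y)
        + s ^ 2 * (frobNorm (D * Y) ^ 2 + frobNorm (Dᵀ * X) ^ 2) := by
  rw [balance_gradient_step]
  refine (frobNorm_add_le _ _).trans ?_
  rw [frobNorm_smul, abs_of_nonneg (sq_nonneg s)]
  gcongr
  refine (frobNorm_sub_le _ _).trans ?_
  have h1 := frobNorm_mul_le (D * Y)ᵀ (D * Y)
  have h2 := frobNorm_mul_le (Dᵀ * X)ᵀ (Dᵀ * X)
  rw [frobNorm_transpose] at h1 h2
  linarith

variable {d₁ d₂ r : ℕ} {M : Matrix (Fin d₁) (Fin d₂) ℝ} {Ω : Set (Fin d₁ × Fin d₂)} {p s β : ℝ}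

/-- A gradient step for the matrix completion objective decreases the objective in proportion to
the squared norm of the gradient. -/
theorem objective_gradient_step_le (hd : d₂ ≤ d₁) (hp : 0 < p) (hs : 0 ≤ s) (hβ : 0 ≤ β)
    (hΩ : HasBoundedDegrees p Ω) (hsβ : 16 * s * d₁ * β ≤ 1)
    {D : Matrix (Fin d₁) (Fin d₂) ℝ} {X X' : Matrix (Fin d₁) (Fin r) ℝ}
    {Y Y' : Matrix (Fin d₂) (Fin r) ℝ} (hD : D = p⁻¹ • proj Ω (X * Yᵀ - M))
    (hX' : X' = X - s • (D * Y)) (hY' : Y' = Y - s • (Dᵀ * X)) (hsD : s * frobNorm D ≤ 1 / 2)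
    (hXβ : ∀ i, ∑ k, X i k ^ 2 ≤ β) (hYβ : ∀ j, ∑ k, Y' j k ^ 2 ≤ β) :
    frobNorm (proj Ω (X' * Y'ᵀ - M)) ^ 2 + s * p * (frobNorm (D * Y) ^ 2 + frobNorm (Dᵀ * X) ^ 2)
      ≤ frobNorm (proj Ω (X * Yᵀ - M)) ^ 2 := by
  set G := D * Y
  set H := Dᵀ * X
  -- Mixing the old `X` with the new `Y'` absorbs the quadratic term of the update; this is why the
  -- row bounds are assumed for `X` and `Y'`.
  have hZ : X' * Y'ᵀ - M = (X * Yᵀ - M) - s • (G * Y'ᵀ + X * Hᵀ) := by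
    have h1 : X * Y'ᵀ = X * Yᵀ - s • (X * Hᵀ) := by
      rw [hY', Matrix.transpose_sub, Matrix.transpose_smul, Matrix.mul_sub, Matrix.mul_smul]
    have h2 : X' * Y'ᵀ = X * Y'ᵀ - s • (G * Y'ᵀ) := by
      rw [hX', Matrix.sub_mul, Matrix.smul_mul]
    rw [h2, h1, smul_add]
    abel
  have hPZ : proj Ω (X * Yᵀ - M) = p • D := by
    rw [hD, smul_smul, mul_inv_cancel₀ hp.ne', one_smul]
  -- Up to the cross term from `Y' ≠ Y`, this is `p` times the squared gradient norm. It contributes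
  -- a decrease `2 s p g`; the cross term and the curvature term each cost at most `s p g / 2`.
  have hin : frobInner (proj Ω (X * Yᵀ - M)) (proj Ω (G * Y'ᵀ + X * Hᵀ))
      = p * (frobNorm G ^ 2 + frobNorm H ^ 2) - s * p * frobInner D (G * Hᵀ) := by
    have h3 : G * Y'ᵀ = G * Yᵀ + (-s) • (G * Hᵀ) := by
      rw [hY', Matrix.transpose_sub, Matrix.transpose_smul, Matrix.mul_sub, Matrix.mul_smul,
        neg_smul, sub_eq_add_neg]
    rw [frobInner_proj_proj, hPZ, frobInner_smul_left, frobInner_add_right, h3,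
      frobInner_add_right, frobInner_smul_right, frobInner_mul_transpose_left D G Y,
      frobInner_mul_transpose_right D X H, frobInner_self, frobInner_self]
    ring
  have hcross : frobInner D (G * Hᵀ) ≤ frobNorm D * ((frobNorm G ^ 2 + frobNorm H ^ 2) / 2) := by
    refine (frobInner_le _ _).trans (mul_le_mul_of_nonneg_left ?_ (frobNorm_nonneg D))
    have h4 := frobNorm_mul_le G Hᵀ
    rw [frobNorm_transpose] at h4
    nlinarith [sq_nonneg (frobNorm G - frobNorm H)]
  have hquad : frobNorm (proj Ω (G * Y'ᵀ + X * Hᵀ)) ^ 2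
      ≤ 8 * p * d₁ * β * (frobNorm G ^ 2 + frobNorm H ^ 2) := by
    rw [proj_add]
    refine (frobNorm_add_sq_le _ _).trans ?_
    have h5 := frobNorm_proj_mul_transpose_sq_le_left G hΩ.1 hβ hYβ
    have h6 := frobNorm_proj_mul_transpose_sq_le_right H hΩ.2 hβ hXβ
    have h7 : 4 * p * d₂ * β * frobNorm G ^ 2 ≤ 4 * p * d₁ * β * frobNorm G ^ 2 := by
      have : (d₂ : ℝ) ≤ d₁ := by exact_mod_cast hd
      gcongr
    linarith
  have hg : 0 ≤ frobNorm G ^ 2 + frobNorm H ^ 2 := by positivity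
  rw [hZ, proj_sub, proj_smul, frobNorm_sub_smul_sq, hin]
  have e1 : 2 * s * (s * p * frobInner D (G * Hᵀ))
      ≤ s * p * ((frobNorm G ^ 2 + frobNorm H ^ 2) / 2) := by
    have : s * p * (2 * s * frobInner D (G * Hᵀ))
        ≤ s * p * (2 * s * (frobNorm D * ((frobNorm G ^ 2 + frobNorm H ^ 2) / 2))) := by gcongr
    have h8 : s * p * ((s * frobNorm D) * (frobNorm G ^ 2 + frobNorm H ^ 2))
        ≤ s * p * (1 / 2 * (frobNorm G ^ 2 + frobNorm H ^ 2)) := by gcongr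
    linarith
  have e2 : s ^ 2 * frobNorm (proj Ω (G * Y'ᵀ + X * Hᵀ)) ^ 2
      ≤ s * p * ((frobNorm G ^ 2 + frobNorm H ^ 2) / 2) := by
    have h9 := mul_le_mul_of_nonneg_left hquad (sq_nonneg s)
    have h10 : s * p / 2 * ((16 * s * d₁ * β) * (frobNorm G ^ 2 + frobNorm H ^ 2))
        ≤ s * p / 2 * (1 * (frobNorm G ^ 2 + frobNorm H ^ 2)) := by gcongr
    linarith
  linarith

variable {X : ℕ → Matrix (Fin d₁) (Fin r) ℝ} {Y : ℕ → Matrix (Fin d₂) (Fin r) ℝ}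

/-- A selection of orthonormal columns is orthonormal, so both Gram matrices are the square of the
diagonal matrix of the `√σ i`. -/
theorem IsSpectralInit.balanced {A : Matrix (Fin d₁) (Fin d₂) ℝ} {X₀ : Matrix (Fin d₁) (Fin r) ℝ}
    {Y₀ : Matrix (Fin d₂) (Fin r) ℝ} (h : IsSpectralInit A X₀ Y₀) : X₀ᵀ * X₀ - Y₀ᵀ * Y₀ = 0 := by
  obtain ⟨_, σ, _, ⟨hr, U, _, V, hA, rfl, -, rfl⟩, rfl, rfl⟩ := h
  have key : ∀ {k d : ℕ} (W : Matrix (Fin k) (Fin d) ℝ) (hr : r ≤ d), Wᵀ * W = 1 →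
      (halfFactor (W.submatrix id (Fin.castLE hr)) σ)ᵀ * halfFactor (W.submatrix id (Fin.castLE hr)) σ
        = (Matrix.diagonal fun i => Real.sqrt (σ i)) * Matrix.diagonal fun i => Real.sqrt (σ i) := by
    intro k d W hr hW
    have h1 : (W.submatrix id (Fin.castLE hr))ᵀ * W.submatrix id (Fin.castLE hr) = 1 := by
      rw [Matrix.transpose_submatrix, ← Matrix.submatrix_mul _ _ _ _ _ Function.bijective_id, hW,
        Matrix.submatrix_one _ (Fin.castLE_injective hr)]
    rw [halfFactor, Matrix.transpose_mul, Matrix.mul_assoc, ← Matrix.mul_assoc _ _ (Matrix.diagonal _),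
      h1, Matrix.one_mul, Matrix.diagonal_transpose]
  rw [key U hr hA.left_orthonormal, key V hr hA.right_orthonormal, sub_self]

theorem IsVanillaGD.stepX' (h : IsVanillaGD M p s Ω X Y) (k : ℕ) :
    X (k + 1) = X k - s • (p⁻¹ • proj Ω (X k * (Y k)ᵀ - M) * Y k) := by
  rw [h.stepX, Matrix.smul_mul, smul_smul, div_eq_mul_inv]

theorem IsVanillaGD.stepY' (h : IsVanillaGD M p s Ω X Y) (k : ℕ) :
    Y (k + 1) = Y k - s • ((p⁻¹ • proj Ω (X k * (Y k)ᵀ - M))ᵀ * X k) := by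
  rw [h.stepY, Matrix.transpose_smul, Matrix.smul_mul, smul_smul, div_eq_mul_inv]

/-- The imbalance that gradient descent accumulates is bounded by the decrease of the objective. -/
theorem IsVanillaGD.balance_add_objective_le (h : IsVanillaGD M p s Ω X Y) (hd : d₂ ≤ d₁)
    (hp : 0 < p) (hs : 0 ≤ s) (hβ : 0 ≤ β) (hΩ : HasBoundedDegrees p Ω)
    (hsβ : 16 * s * d₁ * β ≤ 1) (k : ℕ)
    (hsD : ∀ t ≤ k, s * frobNorm (p⁻¹ • proj Ω (X t * (Y t)ᵀ - M)) ≤ 1 / 2)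
    (hX : ∀ t ≤ k, ∀ i, ∑ a, X t i a ^ 2 ≤ β) (hY : ∀ t ≤ k, ∀ j, ∑ a, Y t j a ^ 2 ≤ β) :
    p * frobNorm ((X k)ᵀ * X k - (Y k)ᵀ * Y k) + s * frobNorm (proj Ω (X k * (Y k)ᵀ - M)) ^ 2
      ≤ s * frobNorm (proj Ω (X 0 * (Y 0)ᵀ - M)) ^ 2 := by
  induction k with
  | zero => rw [h.init.balanced, frobNorm_zero]; simp
  | succ k ih =>
    have ih' := ih (fun t ht => hsD t (by omega)) (fun t ht => hX t (by omega))
      (fun t ht => hY t (by omega))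
    have h1 := objective_gradient_step_le hd hp hs hβ hΩ hsβ rfl (h.stepX' k) (h.stepY' k)
      (hsD k (by omega)) (hX k (by omega)) (hY (k + 1) le_rfl)
    have h2 := frobNorm_balance_gradient_step_le (p⁻¹ • proj Ω (X k * (Y k)ᵀ - M)) (X k) (Y k) s
    rw [← h.stepX' k, ← h.stepY' k] at h2
    -- With these weights the decrease `s · s p g` exactly pays for the growth `p · s² g`.
    have h3 := mul_le_mul_of_nonneg_left h1 hs
    have h4 := mul_le_mul_of_nonneg_left h2 hp.le
    linarith

/-- For a `1 × 1` matrix, gradient descent stays balanced. -/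
theorem IsVanillaGD.balanced_of_unique (hd₁ : d₁ = 1) (hd₂ : d₂ = 1)
    (h : IsVanillaGD M p s Ω X Y) (k : ℕ) : (X k)ᵀ * X k - (Y k)ᵀ * Y k = 0 := by
  subst hd₁ hd₂
  induction k with
  | zero => exact h.init.balanced
  | succ k ih =>
    rw [h.stepX', h.stepY', balance_gradient_step, ih, zero_add]
    set D := p⁻¹ • proj Ω (X k * (Y k)ᵀ - M)
    -- `D` acts as a scalar `c`, so the second-order correction is `-s² c²` times the previous
    -- imbalance, which vanishes.
    have hD : D = Matrix.diagonal fun _ => D 0 0 := by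
      ext i j
      simp [Subsingleton.elim i 0, Subsingleton.elim j 0]
    have h1 : D * Y k = D 0 0 • Y k := by
      conv_lhs => rw [hD]
      exact (Matrix.smul_eq_diagonal_mul (Y k) (D 0 0)).symm
    have h2 : Dᵀ * X k = D 0 0 • X k := by
      conv_lhs => rw [hD, Matrix.diagonal_transpose]
      exact (Matrix.smul_eq_diagonal_mul (X k) (D 0 0)).symm
    rw [h1, h2]
    simp only [Matrix.transpose_smul, Matrix.smul_mul, Matrix.mul_smul, ← smul_sub]
    rw [← neg_sub, ih]
    simp

end GradientDescent

/-! ### Row norms. -/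

section RowNorm

variable {m n : Type*} [Fintype n]

theorem rowNorm_nonneg (A : Matrix m n ℝ) (l : m) : 0 ≤ rowNorm A l := Real.sqrt_nonneg _

theorem rowNorm_sq (A : Matrix m n ℝ) (l : m) : rowNorm A l ^ 2 = ∑ j, A l j ^ 2 :=
  Real.sq_sqrt (Finset.sum_nonneg fun _ _ => sq_nonneg _)

theorem rowNorm_eq_norm (A : Matrix m n ℝ) (l : m) : rowNorm A l = ‖WithLp.toLp 2 (A l)‖ := by
  simp [rowNorm, EuclideanSpace.norm_eq]

theorem rowNorm_add_le (A B : Matrix m n ℝ) (l : m) :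
    rowNorm (A + B) l ≤ rowNorm A l + rowNorm B l := by
  simp only [rowNorm_eq_norm]
  exact norm_add_le (WithLp.toLp 2 (A l)) (WithLp.toLp 2 (B l))

theorem rowNorm_le_frobNorm [Fintype m] (A : Matrix m n ℝ) (l : m) :
    rowNorm A l ≤ frobNorm A := by
  refine le_of_sq_le_sq ?_ (frobNorm_nonneg A)
  rw [rowNorm_sq, frobNorm_sq]
  exact Finset.single_le_sum (f := fun i => ∑ j, A i j ^ 2)
    (fun i _ => Finset.sum_nonneg fun j _ => sq_nonneg _) (Finset.mem_univ l)

theorem rowNorm_le_twoInfNorm [Finite m] (A : Matrix m n ℝ) (l : m) :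
    rowNorm A l ≤ twoInfNorm A :=
  le_ciSup (f := fun l => rowNorm A l) (Set.finite_range _).bddAbove l

theorem rowNorm_mul_orthogonal [DecidableEq n] (A : Matrix m n ℝ) {O : Matrix n n ℝ}
    (hO : O ∈ Matrix.orthogonalGroup n ℝ) (l : m) : rowNorm (A * O) l = rowNorm A l := by
  have h : ∀ B : Matrix m n ℝ, ∑ j, B l j ^ 2 = (B * Bᵀ) l l := fun B => by
    simp [Matrix.mul_apply, sq]
  have hO' : O * Oᵀ = 1 := (Matrix.mem_orthogonalGroup_iff _ _).1 hO
  rw [rowNorm, rowNorm, h, h, Matrix.transpose_mul, Matrix.mul_assoc, ← Matrix.mul_assoc O, hO',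
    Matrix.one_mul]

/-- A row of `F` is controlled through an aligned matrix `G` close to `F`, in which the row is close
to the one of a third matrix. -/
theorem rowNorm_le_of_aligned [Fintype m] [DecidableEq n] (F G H : Matrix m n ℝ)
    {O R Q : Matrix n n ℝ} (hO : O ∈ Matrix.orthogonalGroup n ℝ)
    (hR : R ∈ Matrix.orthogonalGroup n ℝ) (hQ : Q ∈ Matrix.orthogonalGroup n ℝ) (l : m) :
    rowNorm F l ≤ frobNorm (F * O - G * R) + rowNorm (G * Q - H) l + rowNorm H l := by
  -- Rotations preserve row norms, so the rows of `G * R` and `G * Q` can be exchanged although `R`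
  -- and `Q` differ.
  have h1 := rowNorm_add_le (F * O - G * R) (G * R) l
  have h2 := rowNorm_add_le (G * Q - H) H l
  rw [sub_add_cancel, rowNorm_mul_orthogonal _ hO, rowNorm_mul_orthogonal _ hR] at h1
  rw [sub_add_cancel, rowNorm_mul_orthogonal _ hQ] at h2
  linarith [rowNorm_le_frobNorm (F * O - G * R) l]

end RowNorm

/-! ### Singular values and incoherence. -/

section SingularValues

variable {r : ℕ} {σ : Fin r → ℝ}

theorem le_sigmaMax (σ : Fin r → ℝ) (i : Fin r) : σ i ≤ sigmaMax σ :=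
  le_ciSup (Set.finite_range σ).bddAbove i

theorem sigmaMin_le (σ : Fin r → ℝ) (i : Fin r) : sigmaMin σ ≤ σ i :=
  ciInf_le (Set.finite_range σ).bddBelow i

theorem sigmaMin_pos (hr : 0 < r) (hσ : ∀ i, 0 < σ i) : 0 < sigmaMin σ := by
  have : Nonempty (Fin r) := ⟨⟨0, hr⟩⟩
  obtain ⟨i, hi⟩ := exists_eq_ciInf_of_finite (f := σ)
  rw [sigmaMin, ← hi]
  exact hσ i

theorem sigmaMin_le_sigmaMax (hr : 0 < r) (σ : Fin r → ℝ) : sigmaMin σ ≤ sigmaMax σ :=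
  (sigmaMin_le σ ⟨0, hr⟩).trans (le_sigmaMax σ ⟨0, hr⟩)

theorem rowNorm_halfFactor_le {m : Type*} (U : Matrix m (Fin r) ℝ) (hσ : ∀ i, 0 ≤ σ i) (l : m) :
    rowNorm (halfFactor U σ) l ≤ rowNorm U l * Real.sqrt (sigmaMax σ) := by
  rw [rowNorm, rowNorm, ← Real.sqrt_mul (Finset.sum_nonneg fun _ _ => sq_nonneg _),
    Finset.sum_mul]
  refine Real.sqrt_le_sqrt (Finset.sum_le_sum fun j _ => ?_)
  rw [halfFactor, Matrix.mul_diagonal, mul_pow, Real.sq_sqrt (hσ j)]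
  exact mul_le_mul_of_nonneg_left (le_sigmaMax σ j) (sq_nonneg _)

theorem halfFactor_mul_transpose {m n : Type*} (U : Matrix m (Fin r) ℝ) (V : Matrix n (Fin r) ℝ)
    (hσ : ∀ i, 0 ≤ σ i) :
    halfFactor U σ * (halfFactor V σ)ᵀ = U * Matrix.diagonal σ * Vᵀ := by
  rw [halfFactor, halfFactor, Matrix.transpose_mul, Matrix.diagonal_transpose, Matrix.mul_assoc,
    ← Matrix.mul_assoc (Matrix.diagonal _), Matrix.diagonal_mul_diagonal, ← Matrix.mul_assoc]
  simp only [Real.mul_self_sqrt (hσ _)]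

/-- The `d` squared row norms sum to the trace `r` of `Uᵀ U`, while each is at most `μ r / d`. -/
theorem one_le_of_incoherent {d : ℕ} {μ : ℝ} {U : Matrix (Fin d) (Fin r) ℝ} (hr : 0 < r)
    (hU : Uᵀ * U = 1) (h : twoInfNorm U ≤ Real.sqrt (μ * r / d)) : 0 < d ∧ 1 ≤ μ := by
  have hr' : (0 : ℝ) < r := by exact_mod_cast hr
  have h1 : ∑ i, rowNorm U i ^ 2 = r := by
    have h2 : (Uᵀ * U).trace = r := by simp [hU]
    rw [← h2, ← frobInner_eq_trace, frobInner_self, frobNorm_sq]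
    simp only [rowNorm_sq]
  have hd : 0 < d := by
    rcases Nat.eq_zero_or_pos d with rfl | hd
    · simp at h1
      linarith
    · exact hd
  have hd' : (0 : ℝ) < d := by exact_mod_cast hd
  refine ⟨hd, ?_⟩
  have h3 : (r : ℝ) ≤ d * Real.sqrt (μ * r / d) ^ 2 := by
    calc (r : ℝ) = ∑ i, rowNorm U i ^ 2 := h1.symm
      _ ≤ ∑ _i : Fin d, Real.sqrt (μ * r / d) ^ 2 := Finset.sum_le_sum fun i _ =>
          pow_le_pow_left₀ (rowNorm_nonneg U i) ((rowNorm_le_twoInfNorm U i).trans h) 2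
      _ = _ := by simp
  by_contra hμ
  rcases le_total 0 (μ * r / d) with h4 | h4
  · rw [Real.sq_sqrt h4, mul_div_cancel₀ _ hd'.ne'] at h3
    nlinarith
  -- `Real.sqrt` is `0` on nonpositive numbers, which would force `r = 0`.
  · rw [Real.sqrt_eq_zero_of_nonpos h4] at h3
    simp at h3
    omega

end SingularValues

/-- The residual splits as `(X O - X⋆)(Y O)ᵀ + X⋆ (Y O - Y⋆)ᵀ`. Row degrees `4 p d₂` meet the rows
of `Y`, column degrees `4 p d₁` those of `X⋆`. Using `X⋆` rather than `X` in the second term avoids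
a loss of `d₁ / d₂`, since the rows of `X` are only controlled at scale `1 / √d₂`. -/
theorem frobNorm_proj_residual_sq_le {d₁ d₂ r : ℕ} {Ω : Set (Fin d₁ × Fin d₂)} {p α β γ : ℝ}
    (hp : 0 ≤ p) (hΩ : HasBoundedDegrees p Ω) {X Xs : Matrix (Fin d₁) (Fin r) ℝ}
    {Y Ys : Matrix (Fin d₂) (Fin r) ℝ} {O : Matrix (Fin r) (Fin r) ℝ}
    (hO : O ∈ Matrix.orthogonalGroup (Fin r) ℝ) (hα : 0 ≤ α) (hβ : 0 ≤ β) (hαγ : d₁ * α ≤ γ)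
    (hβγ : d₂ * β ≤ γ) (hXs : ∀ i, ∑ k, Xs i k ^ 2 ≤ α) (hY : ∀ j, ∑ k, Y j k ^ 2 ≤ β) :
    frobNorm (proj Ω (X * Yᵀ - Xs * Ysᵀ)) ^ 2
      ≤ 8 * p * γ * frobNorm (Matrix.fromRows X Y * O - Matrix.fromRows Xs Ys) ^ 2 := by
  have hO' : O * Oᵀ = 1 := (Matrix.mem_orthogonalGroup_iff _ _).1 hO
  have hYO : ∀ j, ∑ k, (Y * O) j k ^ 2 ≤ β := fun j => by
    rw [← rowNorm_sq, rowNorm_mul_orthogonal Y hO, rowNorm_sq]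
    exact hY j
  have hsplit : X * Yᵀ - Xs * Ysᵀ = (X * O - Xs) * (Y * O)ᵀ + Xs * (Y * O - Ys)ᵀ := by
    have h1 : X * O * (Y * O)ᵀ = X * Yᵀ := by
      rw [Matrix.transpose_mul, Matrix.mul_assoc, ← Matrix.mul_assoc O, hO', Matrix.one_mul]
    rw [Matrix.sub_mul, h1, Matrix.transpose_sub, Matrix.mul_sub]
    abel
  have hrows : Matrix.fromRows X Y * O - Matrix.fromRows Xs Ys
      = Matrix.fromRows (X * O - Xs) (Y * O - Ys) := by
    rw [Matrix.fromRows_mul]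
    ext (i | i) j <;> simp
  rw [hsplit, proj_add, hrows, frobNorm_fromRows_sq]
  refine (frobNorm_add_sq_le _ _).trans ?_
  have h2 := frobNorm_proj_mul_transpose_sq_le_left (X * O - Xs) hΩ.1 hβ hYO
  have h3 := frobNorm_proj_mul_transpose_sq_le_right (Y * O - Ys) hΩ.2 hα hXs
  have h4 : 4 * p * (d₂ * β) * frobNorm (X * O - Xs) ^ 2
      ≤ 4 * p * γ * frobNorm (X * O - Xs) ^ 2 := by gcongr
  have h5 : 4 * p * (d₁ * α) * frobNorm (Y * O - Ys) ^ 2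
      ≤ 4 * p * γ * frobNorm (Y * O - Ys) ^ 2 := by gcongr
  linarith

/-! ### Numerical consequences of the parameter conditions. -/

section Parameters

/-- The consequences of the conditions on the sampling rate `p` and on the step size for
`w = μ r`, `q = log d₁ / (p d₂)` and `x = s σ_max`. -/
structure AdmissibleParameters (d₁ d₂ w κ p q x : ℝ) : Prop where
  one_le_d₂ : 1 ≤ d₂
  d₂_le : d₂ ≤ d₁
  one_le_w : 1 ≤ w
  w_le : w ≤ d₂
  one_le_κ : 1 ≤ κ
  p_pos : 0 < p
  one_le_p_mul : 1 ≤ p * d₂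
  q_nonneg : 0 ≤ q
  x_nonneg : 0 ≤ x
  q_le : 10 ^ 6 * w ^ 3 * κ ^ 16 * q ≤ 1
  x_le : 10 ^ 8 * d₁ ^ 3 * w * κ ^ 8 * x ^ 2 ≤ d₂ ^ 2

variable {d₁ d₂ w κ p q x : ℝ}

namespace AdmissibleParameters

theorem x_sq_le (h : AdmissibleParameters d₁ d₂ w κ p q x) :
    10 ^ 8 * d₁ * w * κ ^ 8 * x ^ 2 ≤ 1 := by
  have hN : 0 < d₁ := by linarith [h.one_le_d₂, h.d₂_le]
  have h1 : d₂ ^ 2 ≤ d₁ ^ 2 := pow_le_pow_left₀ (by linarith [h.one_le_d₂]) h.d₂_le 2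
  have h2 : d₁ ^ 2 * (10 ^ 8 * d₁ * w * κ ^ 8 * x ^ 2) ≤ d₁ ^ 2 * 1 := by linarith [h.x_le]
  exact le_of_mul_le_mul_left h2 (by positivity)

theorem x_mul_κ_sq_le (h : AdmissibleParameters d₁ d₂ w κ p q x) : x * κ ^ 2 ≤ 1 / 10 ^ 4 := by
  have hκ := h.one_le_κ
  have hN : 1 ≤ d₁ := h.one_le_d₂.trans h.d₂_le
  have h1 : 1 ≤ d₁ * w := one_le_mul_of_one_le_of_one_le hN h.one_le_w
  have h2 : κ ^ 4 ≤ κ ^ 8 := pow_le_pow_right₀ hκ (by norm_num)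
  have h3 : 1 * κ ^ 4 * x ^ 2 ≤ d₁ * w * κ ^ 8 * x ^ 2 := by gcongr
  refine le_of_sq_le_sq ?_ (by norm_num)
  have := h.x_sq_le
  calc (x * κ ^ 2) ^ 2 = 1 * κ ^ 4 * x ^ 2 := by ring
    _ ≤ _ := h3
    _ ≤ _ := by norm_num; linarith

theorem w_pow_mul_q_le (h : AdmissibleParameters d₁ d₂ w κ p q x) {j k : ℕ} (hj : j ≤ 3)
    (hk : k ≤ 16) : w ^ j * κ ^ k * q ≤ 1 / 10 ^ 6 := by
  have h1 : w ^ j ≤ w ^ 3 := pow_le_pow_right₀ h.one_le_w hj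
  have h2 : κ ^ k ≤ κ ^ 16 := pow_le_pow_right₀ h.one_le_κ hk
  have hq := h.q_nonneg
  have hκ := h.one_le_κ
  have hw := h.one_le_w
  have h3 : w ^ j * κ ^ k * q ≤ w ^ 3 * κ ^ 16 * q := by gcongr
  have := h.q_le
  norm_num
  linarith

/-- Makes the coefficient in hypothesis (b) at most `1`. -/
theorem row_error_le (h : AdmissibleParameters d₁ d₂ w κ p q x) :
    10 ^ 3 * (x * κ ^ 2) + 10 ^ 2 * Real.sqrt (w ^ 2 * κ ^ 14 * q) ≤ 1 := by
  have h1 := h.x_mul_κ_sq_le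
  have h2 : Real.sqrt (w ^ 2 * κ ^ 14 * q) ≤ 1 / 10 ^ 3 := by
    refine Real.sqrt_le_iff.2 ⟨by norm_num, ?_⟩
    have := h.w_pow_mul_q_le (j := 2) (k := 14) (by norm_num) (by norm_num)
    norm_num at this ⊢
    linarith
  norm_num at h1 h2 ⊢
  linarith

/-- Brings the Frobenius error of hypothesis (c) down to the scale of a single incoherent row. -/
theorem leave_one_out_error_le (h : AdmissibleParameters d₁ d₂ w κ p q x) :
    x + Real.sqrt (w ^ 2 * κ ^ 10 * q / d₂) ≤ Real.sqrt (w / d₂) := by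
  have hn := h.one_le_d₂
  have hn0 : 0 < d₂ := by linarith
  have hw := h.one_le_w
  have hκ := h.one_le_κ
  have h1 : x ≤ Real.sqrt (w / d₂) / 2 := by
    rw [le_div_iff₀ two_pos]
    refine Real.le_sqrt_of_sq_le ?_
    rw [le_div_iff₀ hn0]
    have h2 : 1 * d₂ * 1 * 1 ≤ 10 ^ 8 * d₁ * w * κ ^ 8 / 4 := by
      have : d₂ * (1 * 1) ≤ d₁ * (w * κ ^ 8) := by
        have := h.d₂_le
        have := one_le_pow₀ hκ (n := 8)
        have : 0 ≤ d₁ := by linarith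
        gcongr
      have : 0 ≤ d₂ * (1 * 1) := by linarith
      norm_num
      linarith
    have h3 : 4 * x ^ 2 * (1 * d₂ * 1 * 1) ≤ 4 * x ^ 2 * (10 ^ 8 * d₁ * w * κ ^ 8 / 4) := by
      gcongr
    linarith [h.x_sq_le]
  have h4 : Real.sqrt (w ^ 2 * κ ^ 10 * q / d₂) ≤ Real.sqrt (w / d₂) / 2 := by
    have : Real.sqrt (w / d₂) / 2 = Real.sqrt (w / d₂ / 4) := by
      rw [Real.sqrt_div (by positivity) 4, show (4 : ℝ) = 2 ^ 2 by norm_num,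
        Real.sqrt_sq (by norm_num)]
    rw [this, div_right_comm w]
    refine Real.sqrt_le_sqrt ?_
    gcongr
    have := h.w_pow_mul_q_le (j := 2) (k := 10) (by norm_num) (by norm_num)
    norm_num at this
    linarith
  linarith

/-- Here `7200 = 100 · 8 · 9`: the target constant, the residual bound and the squared row constant
`3`. In the step-size term `r ≤ d₁` is absorbed by `x_sq_le`; in the sampling term `r ≤ w` yields
the cube of `w`. -/
theorem objective_error_le (h : AdmissibleParameters d₁ d₂ w κ p q x) {r : ℝ} (hr : 0 ≤ r)
    (hrw : r ≤ w) :
    7200 * κ ^ 3 * w * r * (x + Real.sqrt (w * κ ^ 6 * q)) ^ 2 ≤ 1 := by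
  have hw := h.one_le_w
  have hκ := h.one_le_κ
  have hq := h.q_nonneg
  have h1 : (x + Real.sqrt (w * κ ^ 6 * q)) ^ 2 ≤ 2 * (x ^ 2 + w * κ ^ 6 * q) := by
    have := Real.sq_sqrt (show 0 ≤ w * κ ^ 6 * q by positivity)
    nlinarith [sq_nonneg (x - Real.sqrt (w * κ ^ 6 * q))]
  have h2 : κ ^ 3 * w * r * x ^ 2 ≤ 1 / 10 ^ 8 := by
    have hr1 : r ≤ d₁ := hrw.trans (h.w_le.trans h.d₂_le)
    have h3 : κ ^ 3 ≤ κ ^ 8 := pow_le_pow_right₀ hκ (by norm_num)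
    have h4 : κ ^ 3 * w * r * x ^ 2 ≤ κ ^ 8 * w * d₁ * x ^ 2 := by gcongr
    have := h.x_sq_le
    norm_num
    linarith
  have h5 : κ ^ 3 * w * r * (w * κ ^ 6 * q) ≤ 1 / 10 ^ 6 := by
    have h6 : κ ^ 3 * w * r * (w * κ ^ 6 * q) ≤ κ ^ 3 * w * w * (w * κ ^ 6 * q) := by gcongr
    have := h.w_pow_mul_q_le (j := 3) (k := 9) (by norm_num) (by norm_num)
    calc _ ≤ _ := h6
      _ = w ^ 3 * κ ^ 9 * q := by ring
      _ ≤ _ := this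
  calc _ ≤ 7200 * κ ^ 3 * w * r * (2 * (x ^ 2 + w * κ ^ 6 * q)) := by gcongr
    _ = 14400 * (κ ^ 3 * w * r * x ^ 2) + 14400 * (κ ^ 3 * w * r * (w * κ ^ 6 * q)) := by ring
    _ ≤ 14400 * (1 / 10 ^ 8) + 14400 * (1 / 10 ^ 6) := by gcongr
    _ ≤ 1 := by norm_num

/-- The condition `16 s d₁ β ≤ 1` of the descent step with `β = 9 μ r σ_max / d₂`. -/
theorem smoothness_le (h : AdmissibleParameters d₁ d₂ w κ p q x) : 144 * x * d₁ * w ≤ d₂ := by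
  have hn := h.one_le_d₂
  have hN : 1 ≤ d₁ := hn.trans h.d₂_le
  have hw := h.one_le_w
  refine le_of_sq_le_sq ?_ (by linarith)
  have h1 : 144 ^ 2 * w * 1 ≤ 10 ^ 8 * d₁ * κ ^ 8 := by
    have := one_le_pow₀ h.one_le_κ (n := 8)
    have h2 := h.w_le.trans h.d₂_le
    have : w * 1 ≤ d₁ * κ ^ 8 := by gcongr
    nlinarith
  calc (144 * x * d₁ * w) ^ 2 = d₁ ^ 2 * w * x ^ 2 * (144 ^ 2 * w * 1) := by ring
    _ ≤ d₁ ^ 2 * w * x ^ 2 * (10 ^ 8 * d₁ * κ ^ 8) := by gcongr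
    _ = 10 ^ 8 * d₁ ^ 3 * w * κ ^ 8 * x ^ 2 := by ring
    _ ≤ _ := h.x_le

theorem x_sq_le_p (h : AdmissibleParameters d₁ d₂ w κ p q x) : x ^ 2 ≤ p := by
  have hn := h.one_le_d₂
  have h1 : 1 ≤ w * κ ^ 8 :=
    one_le_mul_of_one_le_of_one_le h.one_le_w (one_le_pow₀ h.one_le_κ)
  have h2 : d₂ * x ^ 2 ≤ d₂ * p := by
    have : d₂ * 1 * x ^ 2 ≤ d₁ * (w * κ ^ 8) * x ^ 2 := by
      have := h.d₂_le
      have : 0 ≤ d₁ := by linarith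
      gcongr
    have h3 := h.x_sq_le
    have h4 := h.one_le_p_mul
    have hN : 0 ≤ d₁ := by linarith [h.d₂_le]
    have : 0 ≤ d₁ * (w * κ ^ 8) * x ^ 2 := by positivity
    linarith
  exact le_of_mul_le_mul_left h2 (by linarith)

end AdmissibleParameters

theorem admissibleParameters_of_conditions {d₁ d₂ r : ℕ} {μ κ p S s : ℝ} (hd : d₂ ≤ d₁)
    (hd₂ : 0 < d₂) (hd₁ : 2 ≤ d₁) (hr : 0 < r) (hμ : 1 ≤ μ) (hκ : 1 ≤ κ) (hS : 0 < S) (hp : 0 < p)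
    (hp1 : p ≤ 1) (hrate : SamplingRateCondition (10 ^ 6) d₁ d₂ r μ κ p)
    (hstep : StepSizeCondition (10 ^ 4) d₁ d₂ r μ κ S s) :
    AdmissibleParameters d₁ d₂ (μ * r) κ p (Real.log d₁ / (p * d₂)) (s * S) := by
  have hdR : (d₂ : ℝ) ≤ d₁ := by exact_mod_cast hd
  have hn : (1 : ℝ) ≤ d₂ := by exact_mod_cast hd₂
  have hN : (2 : ℝ) ≤ d₁ := by exact_mod_cast hd₁
  have hrR : (1 : ℝ) ≤ r := by exact_mod_cast hr
  have hw : 1 ≤ μ * r := one_le_mul_of_one_le_of_one_le hμ hrR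
  -- A lower bound on the logarithm turns the sampling rate into `p d₂ ≥ 10⁵ (μ r)³`, hence `p d₂ ≥
  -- 1` and `μ r ≤ d₂`.
  have hL : 1 / 2 ≤ Real.log d₁ := by
    have := Real.log_two_gt_d9
    have := Real.log_le_log two_pos hN
    linarith
  obtain ⟨hs, hs'⟩ := hstep
  rw [SamplingRateCondition, max_eq_left hdR, min_eq_right hdR, div_le_iff₀ (by positivity)] at hrate
  rw [max_eq_left hdR, min_eq_right hdR, le_div_iff₀ (by positivity)] at hs'
  have hκ16 : 1 ≤ κ ^ 16 := one_le_pow₀ hκ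
  have hw3 : 1 ≤ (μ * r) ^ 3 := one_le_pow₀ hw
  have hmass : 10 ^ 6 * (μ * r) ^ 3 * κ ^ 16 * Real.log d₁ ≤ p * d₂ := by
    have h1 : d₂ * (10 ^ 6 * (μ * r) ^ 3 * κ ^ 16 * Real.log d₁)
        ≤ d₁ * (10 ^ 6 * (μ * r) ^ 3 * κ ^ 16 * Real.log d₁) := by gcongr
    have h2 : d₂ * (10 ^ 6 * (μ * r) ^ 3 * κ ^ 16 * Real.log d₁) ≤ d₂ * (p * d₂) := by linarith
    exact le_of_mul_le_mul_left h2 (by linarith)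
  have hmass' : 10 ^ 5 * (μ * r) ^ 3 ≤ p * d₂ := by
    have h3 : 10 ^ 6 * (μ * r) ^ 3 * 1 * (1 / 2) ≤ 10 ^ 6 * (μ * r) ^ 3 * κ ^ 16 * Real.log d₁ := by
      gcongr
    linarith
  refine ⟨hn, hdR, hw, ?_, hκ, hp, by linarith, by positivity, by positivity, ?_, ?_⟩
  · have h4 : μ * r ≤ (μ * r) ^ 3 := le_self_pow₀ hw (by norm_num)
    have h5 : p * d₂ ≤ 1 * d₂ := by gcongr
    linarith
  · rw [← mul_div_assoc, div_le_one (by positivity)]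
    exact hmass
  · have h6 := pow_le_pow_left₀ (by positivity) hs' 2
    have h7 : ((d₁ : ℝ) ^ (3 / 2 : ℝ)) ^ 2 = (d₁ : ℝ) ^ 3 := by
      rw [← Real.rpow_natCast, ← Real.rpow_mul (by positivity), ← Real.rpow_natCast]
      norm_num
    have h8 := Real.sq_sqrt (show 0 ≤ μ * r by positivity)
    calc 10 ^ 8 * (d₁ : ℝ) ^ 3 * (μ * r) * κ ^ 8 * (s * S) ^ 2
        = (s * (10 ^ 4 * (d₁ : ℝ) ^ (3 / 2 : ℝ) * Real.sqrt (μ * r) * κ ^ 4 * S)) ^ 2 := by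
          simp only [mul_pow, h7, h8]
          ring
      _ ≤ _ := h6

end Parameters

/-! ### Deterministic consequences of the induction hypothesis. -/

section Deterministic

variable {d₁ d₂ r : ℕ} {M : Matrix (Fin d₁) (Fin d₂) ℝ} {U : Matrix (Fin d₁) (Fin r) ℝ}
  {σ : Fin r → ℝ} {V : Matrix (Fin d₂) (Fin r) ℝ} {μ p s : ℝ} {Ω : Set (Fin d₁ × Fin d₂)}
  {X : ℕ → Matrix (Fin d₁) (Fin r) ℝ} {Y : ℕ → Matrix (Fin d₂) (Fin r) ℝ}
  {XL : Fin d₁ ⊕ Fin d₂ → ℕ → Matrix (Fin d₁) (Fin r) ℝ}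
  {YL : Fin d₁ ⊕ Fin d₂ → ℕ → Matrix (Fin d₂) (Fin r) ℝ} {t : ℕ}

/-- The `3` counts the distance to the leave-one-out iterate (c), the row error of that iterate (b),
and the row of `F⋆`, each at most the square root. -/
theorem rowNorm_iterate_le (hr : 0 < r) (hσ : ∀ i, 0 < σ i) (hUV : IsIncoherent μ U V)
    (hpar : AdmissibleParameters d₁ d₂ (μ * r) (condNumber σ) p (Real.log d₁ / (p * d₂))
      (s * sigmaMax σ)) (hs : 0 ≤ s)
    (h : InductionHypothesisAt μ p s σ (halfFactor U σ) (halfFactor V σ) X Y XL YL t)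
    (l : Fin d₁ ⊕ Fin d₂) :
    rowNorm (Matrix.fromRows (X t) (Y t)) l
      ≤ 3 * Real.sqrt (μ * r * sigmaMax σ / d₂) := by
  obtain ⟨O, hO, -, hb, hc, -⟩ := h
  obtain ⟨OL, hOL, hb⟩ := hb l
  obtain ⟨R, hR, hc⟩ := hc l
  have hm := sigmaMin_pos hr hσ
  have hmS := sigmaMin_le_sigmaMax hr σ
  have hS : 0 < sigmaMax σ := hm.trans_le hmS
  have hκ := hpar.one_le_κ
  have hn : (0 : ℝ) < d₂ := by linarith [hpar.one_le_d₂]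
  have hw : 0 ≤ μ * r := by linarith [hpar.one_le_w]
  have hs1 : rowNorm (Matrix.fromRows (halfFactor U σ) (halfFactor V σ)) l
      ≤ Real.sqrt (μ * r * sigmaMax σ / d₂) := by
    rw [mul_div_right_comm, Real.sqrt_mul (by positivity)]
    rcases l with i | j
    · refine (rowNorm_halfFactor_le U (fun i => (hσ i).le) i).trans ?_
      gcongr
      refine (rowNorm_le_twoInfNorm U i).trans (hUV.1.trans (Real.sqrt_le_sqrt ?_))
      have := hpar.d₂_le
      gcongr
    · refine (rowNorm_halfFactor_le V (fun i => (hσ i).le) j).trans ?_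
      gcongr
      exact (rowNorm_le_twoInfNorm V j).trans hUV.2
  have hs2 : rowNorm (Matrix.fromRows (XL l t) (YL l t) * OL
      - Matrix.fromRows (halfFactor U σ) (halfFactor V σ)) l
      ≤ 1 * Real.sqrt (μ * r * sigmaMax σ / d₂) := by
    refine hb.trans (mul_le_mul_of_nonneg_right ?_ (Real.sqrt_nonneg _))
    refine le_trans (add_le_add ?_ (le_of_eq ?_)) hpar.row_error_le
    · calc 10 ^ 3 * s * condNumber σ ^ 2 * sigmaMin σ
          ≤ 10 ^ 3 * s * condNumber σ ^ 2 * sigmaMax σ := by gcongr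
        _ = _ := by ring
    · rw [mul_pow, mul_div_assoc]
  have hs3 : frobNorm (Matrix.fromRows (X t) (Y t) * O - Matrix.fromRows (XL l t) (YL l t) * R)
      ≤ Real.sqrt (μ * r * sigmaMax σ / d₂) := by
    rw [mul_div_right_comm, Real.sqrt_mul (by positivity)]
    refine hc.trans (mul_le_mul_of_nonneg_right ?_ (Real.sqrt_nonneg _))
    refine le_trans (add_le_add ?_ (le_of_eq ?_)) hpar.leave_one_out_error_le
    · calc s * sigmaMin σ / condNumber σ ≤ s * sigmaMin σ := div_le_self (by positivity) hκ
        _ ≤ _ := by gcongr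
    · rw [mul_pow, mul_div_assoc, mul_div_assoc, div_div, mul_assoc p, sq (d₂ : ℝ)]
  have := rowNorm_le_of_aligned (Matrix.fromRows (X t) (Y t)) (Matrix.fromRows (XL l t) (YL l t))
    (Matrix.fromRows (halfFactor U σ) (halfFactor V σ)) hO.1 hR.1 hOL.1 l
  linarith

theorem frobNorm_aligned_error_sq_le (hr : 0 < r) (hσ : ∀ i, 0 < σ i) (hs : 0 ≤ s)
    (h : InductionHypothesisAt μ p s σ (halfFactor U σ) (halfFactor V σ) X Y XL YL t) :
    ∃ O ∈ Matrix.orthogonalGroup (Fin r) ℝ,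
      frobNorm (Matrix.fromRows (X t) (Y t) * O
        - Matrix.fromRows (halfFactor U σ) (halfFactor V σ)) ^ 2
      ≤ r * ((s * sigmaMax σ
        + Real.sqrt (μ * r * condNumber σ ^ 6 * (Real.log d₁ / (p * d₂)))) ^ 2 * sigmaMax σ) := by
  obtain ⟨O, hO, ha, -⟩ := h
  refine ⟨O, hO.1, (frobNorm_sq_le_card_mul_opNorm_sq _).trans ?_⟩
  have hm := sigmaMin_pos hr hσ
  have hmS := sigmaMin_le_sigmaMax hr σ
  have hop : 0 ≤ opNorm (Matrix.fromRows (X t) (Y t) * O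
        - Matrix.fromRows (halfFactor U σ) (halfFactor V σ)) := by
    open scoped Matrix.Norms.L2Operator in exact norm_nonneg _
  refine mul_le_mul_of_nonneg_left ?_ (Nat.cast_nonneg r)
  rw [← Real.sq_sqrt (hm.le.trans hmS), ← mul_pow, Real.sq_sqrt (hm.le.trans hmS)]
  refine pow_le_pow_left₀ hop (ha.trans ?_) 2
  rw [mul_div_assoc]
  gcongr

/-- Under the induction hypothesis, the objective stays small. -/
theorem objective_iterate_le (hr : 0 < r) (hM : IsCompactSVD M U σ V) (hUV : IsIncoherent μ U V)
    (hpar : AdmissibleParameters d₁ d₂ (μ * r) (condNumber σ) p (Real.log d₁ / (p * d₂))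
      (s * sigmaMax σ)) (hs : 0 ≤ s) (hμ : 1 ≤ μ) (hΩ : HasBoundedDegrees p Ω)
    (h : InductionHypothesisAt μ p s σ (halfFactor U σ) (halfFactor V σ) X Y XL YL t) :
    100 * condNumber σ * frobNorm (proj Ω (X t * (Y t)ᵀ - M)) ^ 2 ≤ p * sigmaMin σ ^ 2 := by
  have hσ := hM.2
  have hm := sigmaMin_pos hr hσ
  have hmS := sigmaMin_le_sigmaMax hr σ
  have hS : 0 < sigmaMax σ := hm.trans_le hmS
  have hκ := hpar.one_le_κ
  have hp := hpar.p_pos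
  have hn : (0 : ℝ) < d₂ := by linarith [hpar.one_le_d₂]
  have hN : (0 : ℝ) < d₁ := by linarith [hpar.d₂_le]
  have hw : 1 ≤ μ * r := hpar.one_le_w
  have hrow := rowNorm_iterate_le hr hσ hUV hpar hs h
  obtain ⟨O, hO, herr⟩ := frobNorm_aligned_error_sq_le hr hσ hs h
  have hMeq : M = halfFactor U σ * (halfFactor V σ)ᵀ := by
    rw [halfFactor_mul_transpose U V fun i => (hσ i).le]
    exact hM.1.eq
  have hXs : ∀ i, ∑ k, halfFactor U σ i k ^ 2 ≤ μ * r / d₁ * sigmaMax σ := fun i => by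
    have h1 := (rowNorm_halfFactor_le U (fun i => (hσ i).le) i).trans
      (mul_le_mul_of_nonneg_right ((rowNorm_le_twoInfNorm U i).trans hUV.1) (Real.sqrt_nonneg _))
    have h2 := pow_le_pow_left₀ (rowNorm_nonneg _ _) h1 2
    rwa [rowNorm_sq, mul_pow, Real.sq_sqrt (by positivity), Real.sq_sqrt hS.le] at h2
  have hY : ∀ j, ∑ k, Y t j k ^ 2 ≤ 9 * (μ * r * sigmaMax σ / d₂) := fun j => by
    have h2 := pow_le_pow_left₀ (rowNorm_nonneg _ _) (hrow (Sum.inr j)) 2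
    rw [rowNorm_sq, mul_pow, Real.sq_sqrt (by positivity)] at h2
    norm_num at h2
    exact h2
  -- `γ` equals `d₂ β` and dominates `d₁ α = μ r σ_max`.
  have hres := frobNorm_proj_residual_sq_le (γ := 9 * (μ * r) * sigmaMax σ) (X := X t)
    (Ys := halfFactor V σ) hp.le hΩ hO
    (by positivity) (by positivity) (by
      rw [div_mul_eq_mul_div, mul_div_cancel₀ _ hN.ne']
      have : 0 ≤ μ * r * sigmaMax σ := by positivity
      linarith) (le_of_eq (by field_simp)) hXs hY
  rw [← hMeq] at hres
  have hκm : sigmaMax σ = condNumber σ * sigmaMin σ := (div_mul_cancel₀ _ hm.ne').symm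
  have hobj := hpar.objective_error_le (r := r) (Nat.cast_nonneg r)
    (le_mul_of_one_le_left (Nat.cast_nonneg r) hμ)
  set E := (s * sigmaMax σ
    + Real.sqrt (μ * r * condNumber σ ^ 6 * (Real.log d₁ / (p * d₂)))) ^ 2
  calc 100 * condNumber σ * frobNorm (proj Ω (X t * (Y t)ᵀ - M)) ^ 2
      ≤ 100 * condNumber σ * (8 * p * (9 * (μ * r) * sigmaMax σ) * (r * (E * sigmaMax σ))) := by
        refine mul_le_mul_of_nonneg_left (hres.trans ?_) (by positivity)
        exact mul_le_mul_of_nonneg_left herr (by positivity)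
    _ = p * sigmaMin σ ^ 2 * (7200 * condNumber σ ^ 3 * (μ * r) * r * E) := by
        rw [hκm]; ring
    _ ≤ p * sigmaMin σ ^ 2 * 1 := mul_le_mul_of_nonneg_left hobj (by positivity)
    _ = _ := mul_one _

theorem balance_le_of_inductionHypothesis (hd : d₂ ≤ d₁) (hr : 0 < r) (hM : IsCompactSVD M U σ V)
    (hUV : IsIncoherent μ U V)
    (hpar : AdmissibleParameters d₁ d₂ (μ * r) (condNumber σ) p (Real.log d₁ / (p * d₂))
      (s * sigmaMax σ)) (hs : 0 < s) (hμ : 1 ≤ μ) (hΩ : HasBoundedDegrees p Ω)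
    (hGD : IsVanillaGD M p s Ω X Y) (k : ℕ)
    (h : ∀ t ≤ k,
      InductionHypothesisAt μ p s σ (halfFactor U σ) (halfFactor V σ) X Y XL YL t) :
    frobNorm ((X k)ᵀ * X k - (Y k)ᵀ * Y k) ≤ s * sigmaMin σ ^ 2 / (100 * condNumber σ) := by
  have hσ := hM.2
  have hm := sigmaMin_pos hr hσ
  have hmS := sigmaMin_le_sigmaMax hr σ
  have hS : 0 < sigmaMax σ := hm.trans_le hmS
  have hκ := hpar.one_le_κ
  have hp := hpar.p_pos
  have hn : (0 : ℝ) < d₂ := by linarith [hpar.one_le_d₂]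
  have hw : 1 ≤ μ * r := hpar.one_le_w
  have hrow : ∀ t ≤ k, ∀ l, ∑ a, Matrix.fromRows (X t) (Y t) l a ^ 2
      ≤ 9 * (μ * r * sigmaMax σ / d₂) := fun t ht l => by
    have h2 := pow_le_pow_left₀ (rowNorm_nonneg _ _)
      (rowNorm_iterate_le hr hσ hUV hpar hs.le (h t ht) l) 2
    rw [rowNorm_sq, mul_pow, Real.sq_sqrt (by positivity)] at h2
    norm_num at h2 ⊢
    exact h2
  have hobj : ∀ t ≤ k, 100 * condNumber σ * frobNorm (proj Ω (X t * (Y t)ᵀ - M)) ^ 2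
      ≤ p * sigmaMin σ ^ 2 :=
    fun t ht => objective_iterate_le hr hM hUV hpar hs.le hμ hΩ (h t ht)
  -- The small objective and `(s σ_min)² ≤ p` give the square of the left side at most `1 / 100`.
  have hgrad : ∀ t ≤ k, s * frobNorm (p⁻¹ • proj Ω (X t * (Y t)ᵀ - M)) ≤ 1 / 2 := by
    intro t ht
    rw [frobNorm_smul, abs_of_pos (inv_pos.2 hp), ← mul_assoc, mul_comm s, mul_assoc,
      inv_mul_le_iff₀ hp]
    refine le_of_sq_le_sq ?_ (by positivity)
    have h1 : 100 * 1 * frobNorm (proj Ω (X t * (Y t)ᵀ - M)) ^ 2 ≤ p * sigmaMin σ ^ 2 :=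
      le_trans (by gcongr) (hobj t ht)
    have h2 : (s * sigmaMin σ) ^ 2 ≤ p :=
      (pow_le_pow_left₀ (by positivity) (by gcongr) 2).trans hpar.x_sq_le_p
    have h3 : s ^ 2 * (100 * 1 * frobNorm (proj Ω (X t * (Y t)ᵀ - M)) ^ 2)
        ≤ s ^ 2 * (p * sigmaMin σ ^ 2) := by gcongr
    have h4 : p * (s * sigmaMin σ) ^ 2 ≤ p * p := by gcongr
    have h5 : 0 ≤ p * p := by positivity
    rw [mul_pow, mul_pow]
    norm_num
    linarith
  have hsmooth : 16 * s * d₁ * (9 * (μ * r * sigmaMax σ / d₂)) ≤ 1 := by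
    have h1 := hpar.smoothness_le
    rw [← mul_div_assoc, ← mul_div_assoc, div_le_one hn]
    linarith
  have hkey := hGD.balance_add_objective_le hd hp hs.le (by positivity) hΩ hsmooth k hgrad
    (fun t ht i => hrow t ht (Sum.inl i)) (fun t ht j => hrow t ht (Sum.inr j))
  -- Only the initial objective enters the final bound; the later ones serve the step conditions.
  have h0 := hobj 0 (Nat.zero_le k)
  rw [le_div_iff₀ (by positivity)]
  refine le_of_mul_le_mul_left ?_ hp
  have h1 : 0 ≤ s * frobNorm (proj Ω (X k * (Y k)ᵀ - M)) ^ 2 := by positivity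
  calc p * (frobNorm ((X k)ᵀ * X k - (Y k)ᵀ * Y k) * (100 * condNumber σ))
      = 100 * condNumber σ * (p * frobNorm ((X k)ᵀ * X k - (Y k)ᵀ * Y k)) := by ring
    _ ≤ 100 * condNumber σ * (s * frobNorm (proj Ω (X 0 * (Y 0)ᵀ - M)) ^ 2) :=
        mul_le_mul_of_nonneg_left (by linarith) (by positivity)
    _ = s * (100 * condNumber σ * frobNorm (proj Ω (X 0 * (Y 0)ᵀ - M)) ^ 2) := by ring
    _ ≤ s * (p * sigmaMin σ ^ 2) := by gcongr
    _ = _ := by ring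

end Deterministic

/-! ### Failure probability and conclusion. -/

/-- The failure probability of the degree bounds is polynomially small. -/
theorem exp_degree_failure_le {d₁ d₂ : ℕ} {p : ℝ} (hd : d₂ ≤ d₁) (hd₁ : 2 ≤ d₁) (hp : 0 ≤ p)
    (h : 12 * Real.log d₁ ≤ p * d₂) :
    d₁ * Real.exp (-(2 * p * d₂)) + d₂ * Real.exp (-(2 * p * d₁))
      ≤ 1 / ((d₁ : ℝ) + d₂) ^ 11 := by
  have hdR : (d₂ : ℝ) ≤ d₁ := by exact_mod_cast hd
  have hN : (2 : ℝ) ≤ d₁ := by exact_mod_cast hd₁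
  have hn : (0 : ℝ) ≤ d₂ := Nat.cast_nonneg _
  have h1 : Real.exp (-(2 * p * d₁)) ≤ Real.exp (-(2 * p * d₂)) := by gcongr
  have h2 : ((d₁ : ℝ) + d₂) ^ 12 * Real.exp (-(2 * p * d₂)) ≤ 1 := by
    -- Uses `d₁ ≥ 2`. The twelfth power below is the required eleventh plus one for the union over
    -- `d₁ + d₂` lines.
    have h3 : (d₁ : ℝ) + d₂ ≤ (d₁ : ℝ) ^ 2 := by nlinarith
    have h4 : ((d₁ : ℝ) + d₂) ^ 12 ≤ Real.exp (2 * p * d₂) := by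
      calc ((d₁ : ℝ) + d₂) ^ 12 ≤ ((d₁ : ℝ) ^ 2) ^ 12 := by gcongr
        _ = Real.exp (Real.log d₁) ^ 24 := by rw [Real.exp_log (by linarith), ← pow_mul]
        _ = Real.exp (24 * Real.log d₁) := by rw [← Real.exp_nat_mul]; norm_num
        _ ≤ _ := Real.exp_le_exp.2 (by linarith)
    rw [Real.exp_neg, ← div_eq_mul_inv, div_le_one (Real.exp_pos _)]
    exact h4
  have h5 : 0 < (d₁ : ℝ) + d₂ := by linarith
  rw [le_div_iff₀ (by positivity)]
  calc (d₁ * Real.exp (-(2 * p * d₂)) + d₂ * Real.exp (-(2 * p * d₁))) * ((d₁ : ℝ) + d₂) ^ 11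
      ≤ (d₁ * Real.exp (-(2 * p * d₂)) + d₂ * Real.exp (-(2 * p * d₂)))
        * ((d₁ : ℝ) + d₂) ^ 11 := by gcongr
    _ = ((d₁ : ℝ) + d₂) ^ 12 * Real.exp (-(2 * p * d₂)) := by ring
    _ ≤ 1 := h2

theorem lemma4 :
    ∃ C₃ C₄ : ℝ, 0 < C₃ ∧ 0 < C₄ ∧
      ∀ (d₁ d₂ r : ℕ) (_ : d₂ ≤ d₁) (_ : 0 < r)
        (M : Matrix (Fin d₁) (Fin d₂) ℝ)
        (U : Matrix (Fin d₁) (Fin r) ℝ) (σ : Fin r → ℝ) (V : Matrix (Fin d₂) (Fin r) ℝ)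
        (_ : IsCompactSVD M U σ V)
        (μ : ℝ) (_ : IsIncoherent μ U V)
        (p : unitInterval) (_ : 0 < (p : ℝ))
        (_ : SamplingRateCondition C₃ d₁ d₂ r μ (condNumber σ) p),
        1 - 1 / ((d₁ : ℝ) + d₂) ^ 11 ≤
          (ProbabilityTheory.setBernoulli (Set.univ : Set (Fin d₁ × Fin d₂)) p).real
            {Ω | ∀ s : ℝ, StepSizeCondition C₄ d₁ d₂ r μ (condNumber σ) (sigmaMax σ) s →
              ∀ (X : ℕ → Matrix (Fin d₁) (Fin r) ℝ) (Y : ℕ → Matrix (Fin d₂) (Fin r) ℝ),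
              IsVanillaGD M p s Ω X Y →
              ∀ (XL : Fin d₁ ⊕ Fin d₂ → ℕ → Matrix (Fin d₁) (Fin r) ℝ)
                (YL : Fin d₁ ⊕ Fin d₂ → ℕ → Matrix (Fin d₂) (Fin r) ℝ),
              (∀ l, IsLeaveOneOutGD M p s Ω l (XL l) (YL l)) →
              ∀ k : ℕ,
              (∀ t ≤ k, InductionHypothesisAt μ p s σ (halfFactor U σ) (halfFactor V σ)
                X Y XL YL t) →
              frobNorm ((X k)ᵀ * X k - (Y k)ᵀ * Y k)
                ≤ s * sigmaMin σ ^ 2 / (100 * condNumber σ)} := by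
  refine ⟨10 ^ 6, 10 ^ 4, by norm_num, by norm_num, ?_⟩
  intro d₁ d₂ r hd hr M U σ V hM μ hUV p hp hrate
  have hm := sigmaMin_pos hr hM.2
  have hmS := sigmaMin_le_sigmaMax hr σ
  have hS : 0 < sigmaMax σ := hm.trans_le hmS
  have hκ : 1 ≤ condNumber σ := (one_le_div hm).2 hmS
  obtain ⟨hd₂, hμ⟩ := one_le_of_incoherent hr hM.1.right_orthonormal hUV.2
  -- For `d₁ = 1` the logarithm vanishes and the sampling condition is void, but the balance is then
  -- exact for every `Ω`.
  rcases Nat.lt_or_ge d₁ 2 with hlt | hd₁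
  · have hone : d₁ = 1 := by omega
    have hone' : d₂ = 1 := by omega
    rw [Set.eq_univ_of_forall (s := Set.ofPred _) ?_]
    · rw [MeasureTheory.probReal_univ]
      have : (0 : ℝ) ≤ 1 / ((d₁ : ℝ) + d₂) ^ 11 := by positivity
      linarith
    · rintro Ω s ⟨hs, -⟩ X Y hGD XL YL - k -
      rw [hGD.balanced_of_unique hone hone', frobNorm_zero]
      positivity
  · have hmass : 12 * Real.log d₁ ≤ p * d₂ := by
      have hdR : (d₂ : ℝ) ≤ d₁ := by exact_mod_cast hd
      have hn : (0 : ℝ) < d₂ := by exact_mod_cast hd₂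
      have hL : 0 ≤ Real.log d₁ := Real.log_natCast_nonneg d₁
      have hrR : (1 : ℝ) ≤ r := by exact_mod_cast hr
      rw [SamplingRateCondition, max_eq_left hdR, min_eq_right hdR,
        div_le_iff₀ (by positivity)] at hrate
      have h1 : 12 * 1 * 1 * 1 * d₂ * Real.log d₁
          ≤ 10 ^ 6 * μ ^ 3 * r ^ 3 * condNumber σ ^ 16 * d₁ * Real.log d₁ := by
        have := one_le_pow₀ hκ (n := 16)
        have := one_le_pow₀ hμ (n := 3)
        have := one_le_pow₀ hrR (n := 3)
        gcongr
        norm_num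
      refine le_of_mul_le_mul_left ?_ hn
      linarith
    have hdeg := setBernoulli_real_hasBoundedDegrees (d₁ := d₁) (d₂ := d₂) p
    have hfail := exp_degree_failure_le hd hd₁ hp.le hmass
    refine le_trans (by linarith) (hdeg.trans (MeasureTheory.measureReal_mono ?_))
    intro Ω hΩ s hs X Y hGD XL YL _ k hk
    exact balance_le_of_inductionHypothesis hd hr hM hUV
      (admissibleParameters_of_conditions hd hd₂ hd₁ hr hμ hκ hS hp p.2.2 hrate hs) hs.1 hμ hΩ hGD
      k hk
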